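/- Let $(n_k)_{k\ge 1}$ be a lacunary sequence of positive integers, that is, there is $r>1$ with $n_{k+1}\ge r\,n_k$ for all $k\ge 1$. Let $(X,m)$ be a probability space, let $\tau:X\to X$ be a measure-preserving transformation (not necessarily invertible or ergodic), and for a function $f$ on $X$ and $n\ge 1$ put $M_nf=\frac1n\sum_{k=1}^{n} f\circ\tau^k$. Then for every $1<p<\infty$ and every (real- or complex-valued) $f\in L^p(X,m)$, the series $$\sum_{k=1}^{\infty}\bigl(M_{n_{k+1}}f-M_{n_k}f\bigr)$$ is unconditionally convergent in $L^p(X,m)$; that is, for every permutation $\pi$ of $\{1,2,3,\dots\}$ the series $\sum_{k=1}^{\infty}\bigl(M_{n_{\pi(k)+1}}f-M_{n_{\pi(k)}}f\bigr)$ converges in the $L^p$-norm. -/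

import Mathlib

open Filter Topology MeasureTheory
open scoped ENNReal

/-- A sequence of positive integers is lacunary if the ratios of consecutive terms are bounded
below by some constant larger than `1`. -/
def IsLacunary (n : ℕ → ℕ) : Prop :=
  (∀ k, 0 < n k) ∧ ∃ r : ℝ, 1 < r ∧ ∀ k, r * (n k : ℝ) ≤ (n (k + 1) : ℝ)

/-- The series `∑ u k` converges unconditionally: every rearrangement of it converges, as the
limit of its partial sums. -/
def UnconditionallyConvergent {E : Type*} [AddCommMonoid E] [TopologicalSpace E]
    (u : ℕ → E) : Prop :=
  ∀ π : Equiv.Perm ℕ, ∃ s : E,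
    Tendsto (fun N : ℕ => ∑ k ∈ Finset.range N, u (π k)) atTop (𝓝 s)

/-- The ergodic average `M_N f = (1 / N) ∑_{k = 1}^N f ∘ τ^k` on `L^p` of a measure-preserving
transformation `τ`. -/
noncomputable def ergodicAverage {X : Type*} [MeasurableSpace X] {m : Measure X}
    (𝕜 : Type*) [RCLike 𝕜] {p : ℝ≥0∞} {τ : X → X} (hτ : MeasurePreserving τ m m)
    (N : ℕ) (f : Lp 𝕜 p m) : Lp 𝕜 p m :=
  (N : 𝕜)⁻¹ • ∑ k ∈ Finset.Icc 1 N, Lp.compMeasurePreserving (τ^[k]) (hτ.iterate k) f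

/-! The heart of the matter is a bound `‖∑_{k ∈ S} (M_{n_{k+1}} f - M_{n_k} f)‖_p ≤ C ‖f‖_p` with
`C` independent of the finite set `S`. By Calderón's transference, it suffices to prove it for
forward averages on `ℤ`, where the operator is convolution with `diffKernel n S`. This is a
Calderón–Zygmund operator, uniformly in `S`. Its symbol is bounded because `∑ k, |A_{n_{k+1}}(w) -
A_{n_k}(w)|` is bounded on the unit circle: `A_m(w)` is close to `1` for `m` well below `1 / |w -
1|` and close to `0` well above, with errors that form geometric series along a lacunary sequence.
The Hörmander condition (`hormanderBound_diffKernel`) also reduces to a geometric series. The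
Calderón–Zygmund decomposition gives weak type `(1,1)`, Marcinkiewicz interpolation gives `1 < q <
2`, and duality gives `q > 2` (`exists_lpBound`).

Bounded subset sums force summability in the Hilbert space `L^2` (`summable_of_norm_sum_le`). For a
function lying in every `L^r`, this Cauchy property passes to `L^p`: for `p ≤ 2` by inclusion, for
`p > 2` by Cauchy–Schwarz between `L^2` and the bounded `L^{2p-2}` norms. Simple functions are dense
in `L^p`, and the uniform bound extends summability to their closure. A summable series converges in
every order. -/

/-- Convolution on `ℤ` with a kernel supported in `[-R, R]`. -/
noncomputable def zconv {E : Type*} [NormedAddCommGroup E] [NormedSpace ℝ E] (R : ℕ) (K : ℤ → ℝ)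
    (f : ℤ → E) (x : ℤ) : E :=
  ∑ j ∈ Finset.Icc (-R : ℤ) R, K j • f (x - j)

/-! ### Calderón–Zygmund decomposition and the weak type `(1,1)` bound -/

section Zconv

variable {E : Type*} [NormedAddCommGroup E] [NormedSpace ℝ E]

theorem zconv_add (R : ℕ) (K : ℤ → ℝ) (f g : ℤ → E) :
    zconv R K (f + g) = zconv R K f + zconv R K g := by
  funext x
  simp [zconv, smul_add, Finset.sum_add_distrib]

theorem zconv_eq_sum {R : ℕ} {K : ℤ → ℝ} (hK : ∀ j : ℤ, R < j.natAbs → K j = 0)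
    {f : ℤ → E} {U : Finset ℤ} (hf : ∀ y ∉ U, f y = 0) (x : ℤ) :
    zconv R K f x = ∑ y ∈ U, K (x - y) • f y := by
  have h1 : zconv R K f x = ∑' j : ℤ, K j • f (x - j) := by
    rw [tsum_eq_sum (s := Finset.Icc (-R : ℤ) R)]
    · rfl
    · intro j hj
      rw [hK j, zero_smul]
      simp only [Finset.mem_Icc, not_and_or] at hj
      omega
  rw [h1, ← (Equiv.subLeft x).tsum_eq]
  rw [tsum_eq_sum (s := U)]
  · simp
  · intro y hy
    simp [hf y hy]

theorem zconv_support_finite (R : ℕ) (K : ℤ → ℝ) {f : ℤ → E} (hf : f.support.Finite) :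
    (zconv R K f).support.Finite := by
  refine ((Finset.Icc (-R : ℤ) R).finite_toSet.add hf).subset ?_
  intro x hx
  obtain ⟨j, hj, hne⟩ := Finset.exists_ne_zero_of_sum_ne_zero (Function.mem_support.1 hx)
  refine Set.mem_add.2 ⟨j, hj, x - j, ?_, by ring⟩
  exact fun h => hne (by simp [h])

/-- Boundedness of the convolution operator on `ℓ^q` over `ℤ`. -/
def LpBound (E : Type*) [NormedAddCommGroup E] [NormedSpace ℝ E] (R : ℕ) (K : ℤ → ℝ) (q C : ℝ) :
    Prop :=
  ∀ f : ℤ → E, f.support.Finite →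
    ∑' x, ‖zconv R K f x‖ₑ ^ q ≤ ENNReal.ofReal C * ∑' x, ‖f x‖ₑ ^ q

/-- Hörmander's cancellation condition for a kernel on `ℤ`. -/
def HormanderBound (K : ℤ → ℝ) (H : ℝ) : Prop :=
  ∀ y : ℤ, ∑' x : ℤ, (if x.natAbs ≤ 2 * y.natAbs then 0 else ‖K (x - y) - K x‖ₑ) ≤
    ENNReal.ofReal H

/-- A Calderón–Zygmund decomposition `f = g + B` at height `s` on the finite set `I`, with
exceptional set `Ω`. -/
def HasCZ (R : ℕ) (K : ℤ → ℝ) (s H : ℝ) (f : ℤ → E) (I : Finset ℤ) : Prop :=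
  ∃ g B : ℤ → E, ∃ Ω : Finset ℤ,
    (∀ x ∈ I, f x = g x + B x) ∧ (∀ x ∉ I, g x = 0) ∧ (∀ x ∉ I, B x = 0) ∧
    ∑ x ∈ I, ‖g x‖ ^ 2 ≤ 2 * s * ∑ x ∈ I, ‖f x‖ ∧
    s * (Ω.card : ℝ) ≤ 5 * ∑ x ∈ I, ‖f x‖ ∧
    ∑' x, (if x ∈ Ω then 0 else ‖zconv R K B x‖ₑ) ≤ ENNReal.ofReal (2 * H * ∑ x ∈ I, ‖f x‖)

/-- Each bound in `HasCZ` is linear in `∑ x ∈ I, ‖f x‖`, so decompositions on disjoint sets add up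
without loss in the constants. -/
theorem HasCZ.union {R : ℕ} {K : ℤ → ℝ} {s H : ℝ} (hs : 0 ≤ s) (hH : 0 ≤ H) {f : ℤ → E}
    {I J : Finset ℤ} (hIJ : Disjoint I J) (hI : HasCZ R K s H f I) (hJ : HasCZ R K s H f J) :
    HasCZ R K s H f (I ∪ J) := by
  classical
  obtain ⟨g, B, Ω, h1, h2, h3, h4, h5, h6⟩ := hI
  obtain ⟨g', B', Ω', h1', h2', h3', h4', h5', h6'⟩ := hJ
  have hl : ∀ x ∈ I, x ∉ J := fun x hx => Finset.disjoint_left.1 hIJ hx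
  have hr : ∀ x ∈ J, x ∉ I := fun x hx => Finset.disjoint_right.1 hIJ hx
  refine ⟨g + g', B + B', Ω ∪ Ω', ?_, ?_, ?_, ?_, ?_, ?_⟩
  · intro x hx
    rcases Finset.mem_union.1 hx with hx | hx
    · simp [h1 x hx, h2' x (hl x hx), h3' x (hl x hx)]
    · simp [h1' x hx, h2 x (hr x hx), h3 x (hr x hx)]
  · intro x hx
    rw [Finset.mem_union, not_or] at hx
    simp [h2 x hx.1, h2' x hx.2]
  · intro x hx
    rw [Finset.mem_union, not_or] at hx
    simp [h3 x hx.1, h3' x hx.2]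
  · rw [Finset.sum_union hIJ, Finset.sum_union hIJ, mul_add]
    refine add_le_add (le_trans (le_of_eq ?_) h4) (le_trans (le_of_eq ?_) h4')
    · exact Finset.sum_congr rfl fun x hx => by simp [h2' x (hl x hx)]
    · exact Finset.sum_congr rfl fun x hx => by simp [h2 x (hr x hx)]
  · rw [Finset.sum_union hIJ, mul_add]
    refine le_trans ?_ (add_le_add h5 h5')
    rw [← mul_add]
    gcongr
    exact_mod_cast Finset.card_union_le _ _
  · rw [Finset.sum_union hIJ, mul_add, ENNReal.ofReal_add (by positivity) (by positivity)]
    refine le_trans ?_ (add_le_add h6 h6')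
    rw [← ENNReal.tsum_add]
    refine ENNReal.tsum_le_tsum fun x => ?_
    rw [zconv_add]
    by_cases hx : x ∈ Ω <;> by_cases hx' : x ∈ Ω' <;> simp [hx, hx', enorm_add_le]

/-- An atom on an interval has a small image away from the dilated interval. -/
theorem tsum_zconv_atom_le {R : ℕ} {K : ℤ → ℝ} (hK : ∀ j : ℤ, R < j.natAbs → K j = 0)
    {H : ℝ} (hH : HormanderBound K H) {a : ℤ} {L : ℕ} {b : ℤ → E}
    (hb : ∀ x ∉ Finset.Ico a (a + L), b x = 0) (hb0 : ∑ x ∈ Finset.Ico a (a + L), b x = 0) :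
    ∑' x, (if x ∈ Finset.Icc (a - 2 * L) (a + 2 * L) then 0 else ‖zconv R K b x‖ₑ) ≤
      ENNReal.ofReal H * ∑ x ∈ Finset.Ico a (a + L), ‖b x‖ₑ := by
  set I := Finset.Ico a (a + L)
  set Ω := Finset.Icc (a - 2 * L) (a + 2 * L) with hΩ
  -- Since `b` has mean zero, the constant `K (x - a)` may be subtracted from the kernel.
  have key : ∀ x, ‖zconv R K b x‖ₑ ≤ ∑ y ∈ I, ‖K (x - y) - K (x - a)‖ₑ * ‖b y‖ₑ := by
    intro x
    have : zconv R K b x = ∑ y ∈ I, (K (x - y) - K (x - a)) • b y := by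
      rw [zconv_eq_sum hK hb]
      simp only [sub_smul, Finset.sum_sub_distrib]
      rw [← Finset.smul_sum, hb0, smul_zero, sub_zero]
    rw [this]
    refine (enorm_sum_le _ _).trans (Finset.sum_le_sum fun y _ => ?_)
    rw [enorm_smul]
  calc ∑' x, (if x ∈ Ω then 0 else ‖zconv R K b x‖ₑ)
      ≤ ∑' x, ∑ y ∈ I, (if x ∈ Ω then 0 else ‖K (x - y) - K (x - a)‖ₑ) * ‖b y‖ₑ := by
        refine ENNReal.tsum_le_tsum fun x => ?_
        by_cases hx : x ∈ Ω
        · simp [hx]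
        · simpa [hx] using key x
    _ = ∑ y ∈ I, (∑' x, if x ∈ Ω then 0 else ‖K (x - y) - K (x - a)‖ₑ) * ‖b y‖ₑ := by
        rw [Summable.tsum_finsetSum fun _ _ => ENNReal.summable]
        simp_rw [ENNReal.tsum_mul_right]
    _ ≤ ∑ y ∈ I, ENNReal.ofReal H * ‖b y‖ₑ := by
        refine Finset.sum_le_sum fun y hy => ?_
        gcongr
        -- After recentring at `a`, a point outside `Ω` satisfies `|x| > 2 * L ≥ 2 * |y - a|`, which
        -- is the range of Hörmander's condition.
        refine le_trans ?_ (hH (y - a))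
        rw [← (Equiv.addRight a).tsum_eq]
        refine ENNReal.tsum_le_tsum fun x => ?_
        have hy' := Finset.mem_Ico.1 hy
        by_cases h1 : Equiv.addRight a x ∈ Ω
        · rw [if_pos h1]
          exact bot_le
        · have h1' : ¬ (a - 2 * L ≤ x + a ∧ x + a ≤ a + 2 * L) := by
            rw [hΩ, Finset.mem_Icc] at h1
            exact h1
          rw [if_neg h1, show Equiv.addRight a x = x + a from rfl, if_neg (by omega : ¬ x.natAbs ≤ 2 * (y - a).natAbs),
            show x + a - y = x - (y - a) by ring, show x + a - a = x by ring]
    _ = ENNReal.ofReal H * ∑ x ∈ I, ‖b x‖ₑ := by rw [Finset.mul_sum]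

omit [NormedSpace ℝ E] in
theorem sum_enorm_eq_ofReal (I : Finset ℤ) (f : ℤ → E) :
    ∑ x ∈ I, ‖f x‖ₑ = ENNReal.ofReal (∑ x ∈ I, ‖f x‖) := by
  rw [ENNReal.ofReal_sum_of_nonneg fun _ _ => norm_nonneg _]
  simp

/-- A stopping interval. The good part is the mean `v`, with `‖v‖ ≤ 2 * s` and `L * ‖v‖ ≤ N`; the
bad part `f - v` is one atom of norm at most `2 * N`. The dilated interval has `4 * L + 1 ≤ 5 * L`
points, and `s * L ≤ N` pays for them. -/
theorem HasCZ.of_large {R : ℕ} {K : ℤ → ℝ} (hK : ∀ j : ℤ, R < j.natAbs → K j = 0)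
    {s H : ℝ} (hs : 0 < s) (hH0 : 0 ≤ H) (hH : HormanderBound K H) {f : ℤ → E} {a : ℤ} {L : ℕ}
    (hL : 0 < L) (h1 : s * L ≤ ∑ x ∈ Finset.Ico a (a + L), ‖f x‖)
    (h2 : ∑ x ∈ Finset.Ico a (a + L), ‖f x‖ ≤ 2 * s * L) :
    HasCZ R K s H f (Finset.Ico a (a + L)) := by
  classical
  set I := Finset.Ico a (a + L) with hI
  set N := ∑ x ∈ I, ‖f x‖
  set v : E := (L : ℝ)⁻¹ • ∑ x ∈ I, f x with hv
  have hL' : (0 : ℝ) < L := by exact_mod_cast hL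
  have hcard : I.card = L := by simp [hI]
  have hvN : L * ‖v‖ ≤ N := by
    rw [hv, norm_smul, norm_inv, Real.norm_natCast, ← mul_assoc, mul_inv_cancel₀ hL'.ne', one_mul]
    exact norm_sum_le _ _
  have hLv : (L : ℝ) • v = ∑ x ∈ I, f x := by rw [hv, smul_inv_smul₀ hL'.ne']
  set b : ℤ → E := fun x => if x ∈ I then f x - v else 0 with hb
  have hbs : ∑ x ∈ I, b x = 0 := by
    have : ∑ x ∈ I, b x = ∑ x ∈ I, (f x - v) :=
      Finset.sum_congr rfl fun x hx => by simp [hb, hx]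
    rw [this, Finset.sum_sub_distrib, Finset.sum_const, hcard, ← hLv, Nat.cast_smul_eq_nsmul,
      sub_self]
  have hbn : ∑ x ∈ I, ‖b x‖ ≤ 2 * N := by
    calc ∑ x ∈ I, ‖b x‖ ≤ ∑ x ∈ I, (‖f x‖ + ‖v‖) :=
          Finset.sum_le_sum fun x hx => by simpa [hb, hx] using norm_sub_le _ _
      _ = N + L * ‖v‖ := by rw [Finset.sum_add_distrib, Finset.sum_const, hcard, nsmul_eq_mul]
      _ ≤ 2 * N := by linarith
  refine ⟨fun x => if x ∈ I then v else 0, b, Finset.Icc (a - 2 * L) (a + 2 * L),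
    fun x hx => by simp [hb, hx], fun x hx => by simp [hx], fun x hx => by simp [hb, hx],
    ?_, ?_, ?_⟩
  · have : ∑ x ∈ I, ‖if x ∈ I then v else 0‖ ^ 2 = ∑ x ∈ I, ‖v‖ ^ 2 :=
      Finset.sum_congr rfl fun x hx => by simp [hx]
    rw [this, Finset.sum_const, hcard, nsmul_eq_mul]
    have hv2 : ‖v‖ ≤ 2 * s := by
      by_contra! h
      nlinarith
    nlinarith [norm_nonneg v]
  · have h5 : ((Finset.Icc (a - 2 * L) (a + 2 * L)).card : ℝ) ≤ 5 * L := by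
      have : (Finset.Icc (a - 2 * L) (a + 2 * L)).card ≤ 5 * L := by
        rw [Int.card_Icc]
        omega
      exact_mod_cast this
    nlinarith
  · refine (tsum_zconv_atom_le hK hH (fun x hx => if_neg hx) hbs).trans ?_
    rw [sum_enorm_eq_ofReal, ← ENNReal.ofReal_mul hH0]
    apply ENNReal.ofReal_le_ofReal
    nlinarith

/-- The stopping-time argument, as an induction on scale. If the average over an interval is at most
`s`, each half has average at most `2 * s`: a half with average at least `s` stops there, and the
other kind is split again. At a single point `‖f a‖ ≤ s`, so `f` itself is good. -/
theorem hasCZ_dyadic {R : ℕ} {K : ℤ → ℝ} (hK : ∀ j : ℤ, R < j.natAbs → K j = 0)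
    {s H : ℝ} (hs : 0 < s) (hH0 : 0 ≤ H) (hH : HormanderBound K H) (f : ℤ → E) (j : ℕ) :
    ∀ a : ℤ, ∑ x ∈ Finset.Ico a (a + (2 ^ j : ℕ)), ‖f x‖ ≤ s * (2 ^ j : ℕ) →
      HasCZ R K s H f (Finset.Ico a (a + (2 ^ j : ℕ))) := by
  induction j with
  | zero =>
    intro a ha
    have hI : Finset.Ico a (a + (2 ^ 0 : ℕ)) = {a} := by
      ext x
      simp
      omega
    rw [hI] at ha ⊢
    simp only [Finset.sum_singleton, pow_zero, Nat.cast_one, mul_one] at ha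
    refine ⟨fun x => if x = a then f a else 0, 0, ∅, by simp, fun x hx => if_neg (by simpa using hx),
      by simp, ?_, ?_, ?_⟩
    · simp only [Finset.sum_singleton, if_true]
      nlinarith [norm_nonneg (f a)]
    · simp
    · simp [zconv]
  | succ j ih =>
    intro a ha
    have hpos : 0 < 2 ^ j := by positivity
    have hcast : (2 ^ (j + 1) : ℕ) = 2 ^ j + 2 ^ j := by ring
    have hI : Finset.Ico a (a + (2 ^ (j + 1) : ℕ)) =
        Finset.Ico a (a + (2 ^ j : ℕ)) ∪
          Finset.Ico (a + (2 ^ j : ℕ)) (a + (2 ^ j : ℕ) + (2 ^ j : ℕ)) := by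
      rw [Finset.Ico_union_Ico_eq_Ico (by omega) (by omega), hcast]
      push_cast
      ring_nf
    have hd : Disjoint (Finset.Ico a (a + (2 ^ j : ℕ)))
        (Finset.Ico (a + (2 ^ j : ℕ)) (a + (2 ^ j : ℕ) + (2 ^ j : ℕ))) :=
      Finset.Ico_disjoint_Ico_consecutive _ _ _
    rw [hI] at ha ⊢
    rw [Finset.sum_union hd, hcast, Nat.cast_add] at ha
    have n1 : 0 ≤ ∑ x ∈ Finset.Ico a (a + (2 ^ j : ℕ)), ‖f x‖ :=
      Finset.sum_nonneg fun _ _ => norm_nonneg _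
    have n2 : 0 ≤ ∑ x ∈ Finset.Ico (a + (2 ^ j : ℕ)) (a + (2 ^ j : ℕ) + (2 ^ j : ℕ)), ‖f x‖ :=
      Finset.sum_nonneg fun _ _ => norm_nonneg _
    have half : ∀ c : ℤ, ∑ x ∈ Finset.Ico c (c + (2 ^ j : ℕ)), ‖f x‖ ≤ 2 * s * (2 ^ j : ℕ) →
        HasCZ R K s H f (Finset.Ico c (c + (2 ^ j : ℕ))) := by
      intro c hc
      rcases le_total (∑ x ∈ Finset.Ico c (c + (2 ^ j : ℕ)), ‖f x‖) (s * (2 ^ j : ℕ)) with h | h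
      · exact ih c h
      · exact HasCZ.of_large hK hs hH0 hH hpos h hc
    exact (half a (by linarith)).union hs.le hH0 hd (half _ (by linarith))

/-- The starting interval contains the support (length over `2 * M + 1`) and is long enough (over `N
/ s`) for the average to be at most `s`. -/
theorem exists_hasCZ {R : ℕ} {K : ℤ → ℝ} (hK : ∀ j : ℤ, R < j.natAbs → K j = 0)
    {s H : ℝ} (hs : 0 < s) (hH0 : 0 ≤ H) (hH : HormanderBound K H) {f : ℤ → E}
    (hf : f.support.Finite) : ∃ I : Finset ℤ, (∀ x ∉ I, f x = 0) ∧ HasCZ R K s H f I := by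
  set N := ∑ x ∈ hf.toFinset, ‖f x‖
  obtain ⟨M, hM⟩ : ∃ M : ℕ, ∀ x ∈ hf.toFinset, x.natAbs ≤ M :=
    ⟨hf.toFinset.sup Int.natAbs, fun x hx => Finset.le_sup (f := Int.natAbs) hx⟩
  obtain ⟨j, hj⟩ : ∃ j : ℕ, N / s + (2 * M + 1) < 2 ^ j := pow_unbounded_of_one_lt _ one_lt_two
  have hN : 0 ≤ N := Finset.sum_nonneg fun _ _ => norm_nonneg _
  have h1 : 2 * M + 1 < 2 ^ j := by
    have : ((2 * M + 1 : ℕ) : ℝ) < ((2 ^ j : ℕ) : ℝ) := by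
      push_cast
      linarith [div_nonneg hN hs.le]
    exact_mod_cast this
  have h2 : N ≤ s * (2 ^ j : ℕ) := by
    have : N / s < (2 ^ j : ℕ) := by
      push_cast
      linarith [(Nat.cast_nonneg M : (0 : ℝ) ≤ M)]
    rw [div_lt_iff₀ hs] at this
    linarith
  have hsub : hf.toFinset ⊆ Finset.Ico (-M : ℤ) (-M + (2 ^ j : ℕ)) := by
    intro x hx
    have := hM x hx
    rw [Finset.mem_Ico]
    omega
  have h0 : ∀ x ∉ Finset.Ico (-M : ℤ) (-M + (2 ^ j : ℕ)), f x = 0 := by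
    intro x hx
    by_contra hne
    exact hx (hsub (by simpa using hne))
  refine ⟨_, h0, hasCZ_dyadic hK hs hH0 hH f j _ ?_⟩
  rw [← Finset.sum_subset hsub]
  · exact h2
  · intro x _ hx
    simpa using hx

theorem mul_count_lt_le (h : ℤ → ℝ≥0∞) (s : ℝ≥0∞) :
    s * Measure.count {x | s < h x} ≤ ∑' x, h x := by
  rw [← lintegral_count]
  refine le_trans ?_ (mul_meas_ge_le_lintegral (measurable_of_countable h) s)
  gcongr
  exact fun hx => le_of_lt hx

/-- The weak type `(1,1)` bound of a Calderón–Zygmund operator on `ℤ`. -/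
theorem zconv_weak_type {R : ℕ} {K : ℤ → ℝ} (hK : ∀ j : ℤ, R < j.natAbs → K j = 0)
    {A H : ℝ} (hA0 : 0 ≤ A) (hA : LpBound E R K 2 A) (hH0 : 0 ≤ H) (hH : HormanderBound K H)
    {f : ℤ → E} (hf : f.support.Finite) {s : ℝ} (hs : 0 < s) :
    ENNReal.ofReal s * Measure.count {x | ENNReal.ofReal (2 * s) < ‖zconv R K f x‖ₑ} ≤
      ENNReal.ofReal (2 * A + 5 + 2 * H) * ∑' x, ‖f x‖ₑ := by
  obtain ⟨I, hI, g, B, Ω, h1, h2, h3, h4, h5, h6⟩ := exists_hasCZ hK hs hH0 hH hf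
  set N := ∑ x ∈ I, ‖f x‖ with hN
  have hN0 : 0 ≤ N := Finset.sum_nonneg fun _ _ => norm_nonneg _
  have hfN : ∑' x, ‖f x‖ₑ = ENNReal.ofReal N := by
    rw [tsum_eq_sum (s := I) (fun x hx => by simp [hI x hx]), sum_enorm_eq_ofReal]
  have hfgB : f = g + B := by
    funext x
    by_cases hx : x ∈ I
    · exact h1 x hx
    · simp [hI x hx, h2 x hx, h3 x hx]
  have hs0 : ENNReal.ofReal s ≠ 0 := by simpa using hs
  set S1 := {x : ℤ | ENNReal.ofReal s < ‖zconv R K g x‖ₑ}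
  set S3 := {x : ℤ | ENNReal.ofReal s < if x ∈ Ω then 0 else ‖zconv R K B x‖ₑ}
  have hsub : {x | ENNReal.ofReal (2 * s) < ‖zconv R K f x‖ₑ} ⊆ S1 ∪ (Ω : Set ℤ) ∪ S3 := by
    intro x hx
    by_contra hcon
    simp only [S1, S3, Set.mem_union, Set.mem_ofPred_eq, not_or, not_lt] at hcon
    obtain ⟨⟨c1, c2⟩, c3⟩ := hcon
    rw [if_neg (by simpa using c2)] at c3
    refine absurd (show ENNReal.ofReal (2 * s) < ‖zconv R K f x‖ₑ from hx) (not_lt.2 ?_)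
    rw [hfgB, zconv_add, two_mul, ENNReal.ofReal_add hs.le hs.le]
    exact (enorm_add_le _ _).trans (add_le_add c1 c3)
  -- Chebyshev at exponent `2`: the level `s ^ 2` on the left against `A * (2 * s * N)` on the
  -- right, so one factor `s` cancels.
  have b1 : ENNReal.ofReal s * Measure.count S1 ≤ ENNReal.ofReal (2 * A * N) := by
    have hgs : g.support.Finite := I.finite_toSet.subset fun x hx => by
      by_contra hxI
      exact hx (h2 x hxI)
    have hg2 : ∑' x, ‖g x‖ₑ ^ (2 : ℝ) ≤ ENNReal.ofReal (2 * s * N) := by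
      rw [tsum_eq_sum (s := I) (fun x hx => by simp [h2 x hx])]
      refine le_trans (le_of_eq ?_) (ENNReal.ofReal_le_ofReal h4)
      rw [ENNReal.ofReal_sum_of_nonneg fun _ _ => by positivity]
      refine Finset.sum_congr rfl fun x _ => ?_
      rw [ENNReal.ofReal_pow (norm_nonneg _), ofReal_norm, ENNReal.rpow_two]
    have hm := mul_count_lt_le (fun x => ‖zconv R K g x‖ₑ ^ (2 : ℝ)) (ENNReal.ofReal s ^ (2 : ℝ))
    have hset : {x | ENNReal.ofReal s ^ (2 : ℝ) < ‖zconv R K g x‖ₑ ^ (2 : ℝ)} = S1 := by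
      ext x
      exact ENNReal.rpow_lt_rpow_iff two_pos
    rw [hset] at hm
    have hc := (hm.trans (hA g hgs)).trans (mul_le_mul_right hg2 _)
    rw [← ENNReal.ofReal_mul hA0, ENNReal.rpow_two, pow_two, mul_assoc,
      show A * (2 * s * N) = s * (2 * A * N) by ring, ENNReal.ofReal_mul hs.le] at hc
    exact (ENNReal.mul_le_mul_iff_right hs0 ENNReal.ofReal_ne_top).1 hc
  have b2 : ENNReal.ofReal s * Measure.count (Ω : Set ℤ) ≤ ENNReal.ofReal (5 * N) := by
    rw [Measure.count_apply_finset, ← ENNReal.ofReal_natCast, ← ENNReal.ofReal_mul hs.le]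
    exact ENNReal.ofReal_le_ofReal h5
  have b3 : ENNReal.ofReal s * Measure.count S3 ≤ ENNReal.ofReal (2 * H * N) :=
    (mul_count_lt_le _ _).trans h6
  calc _ ≤ ENNReal.ofReal s * (Measure.count S1 + Measure.count (Ω : Set ℤ) +
        Measure.count S3) := by
        gcongr
        exact (measure_mono hsub).trans ((measure_union_le _ _).trans
          (add_le_add (measure_union_le _ _) le_rfl))
    _ ≤ ENNReal.ofReal (2 * A * N) + ENNReal.ofReal (5 * N) + ENNReal.ofReal (2 * H * N) := by
        rw [mul_add, mul_add]
        exact add_le_add (add_le_add b1 b2) b3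
    _ = _ := by
        rw [hfN, ← ENNReal.ofReal_mul (by positivity), ← ENNReal.ofReal_add (by positivity)
          (by positivity), ← ENNReal.ofReal_add (by positivity) (by positivity)]
        congr 1
        ring

end Zconv

/-! ### Marcinkiewicz interpolation between weak type `(1,1)` and `ℓ²` -/

theorem lintegral_Ioi_ite_lt_rpow {a r : ℝ} (ha : 0 < a) (hr : -1 < r) :
    ∫⁻ s in Set.Ioi (0 : ℝ), (if s < a then ENNReal.ofReal (s ^ r) else 0) ≤
      ENNReal.ofReal (a ^ (r + 1) / (r + 1)) := by
  have h1 : ∫⁻ s in Set.Ioi (0 : ℝ), (if s < a then ENNReal.ofReal (s ^ r) else 0) ≤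
      ∫⁻ s in Set.Ioc 0 a, ENNReal.ofReal (s ^ r) := by
    rw [← lintegral_indicator measurableSet_Ioi, ← lintegral_indicator measurableSet_Ioc]
    refine lintegral_mono fun s => ?_
    by_cases h0 : 0 < s <;> by_cases h : s < a <;> simp [Set.indicator, h0, h, le_of_lt]
  refine h1.trans ?_
  have hi := (intervalIntegral.intervalIntegrable_rpow' (a := 0) (b := a) hr).1
  rw [← ofReal_integral_eq_lintegral_ofReal hi, ← intervalIntegral.integral_of_le ha.le,
    integral_rpow (Or.inl hr), Real.zero_rpow (by linarith), sub_zero]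
  exact (ae_restrict_iff' measurableSet_Ioc).2 (ae_of_all _ fun s hs =>
    Real.rpow_nonneg hs.1.le _)

theorem lintegral_Ioi_ite_le_rpow {a r : ℝ} (ha : 0 < a) (hr : r < -1) :
    ∫⁻ s in Set.Ioi (0 : ℝ), (if a ≤ s then ENNReal.ofReal (s ^ r) else 0) ≤
      ENNReal.ofReal (a ^ (r + 1) / (-(r + 1))) := by
  have h1 : ∫⁻ s in Set.Ioi (0 : ℝ), (if a ≤ s then ENNReal.ofReal (s ^ r) else 0) ≤
      ∫⁻ s in Set.Ici a, ENNReal.ofReal (s ^ r) := by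
    rw [← lintegral_indicator measurableSet_Ioi, ← lintegral_indicator measurableSet_Ici]
    refine lintegral_mono fun s => ?_
    by_cases h0 : 0 < s <;> by_cases h : a ≤ s <;> simp [Set.indicator, h0, h]
  refine h1.trans ?_
  rw [setLIntegral_congr Ioi_ae_eq_Ici.symm,
    ← ofReal_integral_eq_lintegral_ofReal (integrableOn_Ioi_rpow_of_lt hr ha),
    integral_Ioi_rpow_of_lt hr ha, div_neg, neg_div]
  exact (ae_restrict_iff' measurableSet_Ioi).2 (ae_of_all _ fun s hs =>
    Real.rpow_nonneg (ha.trans hs).le _)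

section Marcinkiewicz

variable {E : Type*} [NormedAddCommGroup E] [NormedSpace ℝ E]

/-- Cut `f` at the height `s`. If the image exceeds `4 * s`, then the image of one piece exceeds `2
* s`; the high piece is controlled by the weak type bound and the low piece by Chebyshev and `ℓ²`.
These consume one and two powers of `s`, leaving the weights `s ^ (q - 2)` and `s ^ (q - 3)`. -/
theorem count_zconv_lt_le {R : ℕ} {K : ℤ → ℝ} (hK : ∀ j : ℤ, R < j.natAbs → K j = 0)
    {A H : ℝ} (hA0 : 0 ≤ A) (hA : LpBound E R K 2 A) (hH0 : 0 ≤ H) (hH : HormanderBound K H)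
    {f : ℤ → E} (hf : f.support.Finite) (q : ℝ) {s : ℝ} (hs : 0 < s) :
    Measure.count {x | s < ‖zconv R K f x‖ / 4} * ENNReal.ofReal (s ^ (q - 1)) ≤
      ∑' x, (ENNReal.ofReal ((2 * A + 5 + 2 * H) * ‖f x‖) *
          (if s < ‖f x‖ then ENNReal.ofReal (s ^ (q - 2)) else 0) +
        ENNReal.ofReal (A * ‖f x‖ ^ 2) *
          (if ‖f x‖ ≤ s then ENNReal.ofReal (s ^ (q - 3)) else 0)) := by
  classical
  set fh : ℤ → E := fun x => if s < ‖f x‖ then f x else 0 with hfh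
  set fl : ℤ → E := fun x => if ‖f x‖ ≤ s then f x else 0 with hfl
  have hsum : f = fh + fl := by
    funext x
    by_cases h : s < ‖f x‖
    · simp [hfh, hfl, h, not_le.2 h]
    · simp [hfh, hfl, h, not_lt.1 h]
  have hfhs : fh.support.Finite := hf.subset fun x hx h0 => hx (by
    have : f x = 0 := h0
    simp [hfh, this])
  have hfls : fl.support.Finite := hf.subset fun x hx h0 => hx (by
    have : f x = 0 := h0
    simp [hfl, this])
  set S1 := {x | ENNReal.ofReal (2 * s) < ‖zconv R K fh x‖ₑ}
  set S2 := {x | ENNReal.ofReal (2 * s) < ‖zconv R K fl x‖ₑ}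
  have hsub : {x | s < ‖zconv R K f x‖ / 4} ⊆ S1 ∪ S2 := by
    intro x hx
    have hx' : s < ‖zconv R K f x‖ / 4 := hx
    by_contra hcon
    simp only [S1, S2, Set.mem_union, Set.mem_ofPred_eq, not_or, not_lt] at hcon
    rw [← ofReal_norm, ← ofReal_norm, ENNReal.ofReal_le_ofReal_iff (by positivity),
      ENNReal.ofReal_le_ofReal_iff (by positivity)] at hcon
    rw [hsum, zconv_add] at hx'
    have := norm_add_le (zconv R K fh x) (zconv R K fl x)
    rw [← Pi.add_apply] at this
    linarith [hcon.1, hcon.2]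
  have b1 : Measure.count S1 * ENNReal.ofReal (s ^ (q - 1)) ≤
      ∑' x, ENNReal.ofReal ((2 * A + 5 + 2 * H) * ‖f x‖) *
          (if s < ‖f x‖ then ENNReal.ofReal (s ^ (q - 2)) else 0) := by
    have hw := zconv_weak_type hK hA0 hA hH0 hH hfhs hs
    calc Measure.count S1 * ENNReal.ofReal (s ^ (q - 1))
        = (ENNReal.ofReal s * Measure.count S1) * ENNReal.ofReal (s ^ (q - 2)) := by
          rw [show q - 1 = 1 + (q - 2) by ring, Real.rpow_add hs, Real.rpow_one,
            ENNReal.ofReal_mul hs.le]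
          ring
      _ ≤ (ENNReal.ofReal (2 * A + 5 + 2 * H) * ∑' x, ‖fh x‖ₑ) *
          ENNReal.ofReal (s ^ (q - 2)) := mul_le_mul_left hw _
      _ = _ := by
          rw [← ENNReal.tsum_mul_left, ← ENNReal.tsum_mul_right]
          refine tsum_congr fun x => ?_
          rw [ENNReal.ofReal_mul (by positivity), ofReal_norm]
          by_cases h : s < ‖f x‖ <;> simp [hfh, h]
  have b2 : Measure.count S2 * ENNReal.ofReal (s ^ (q - 1)) ≤
      ∑' x, ENNReal.ofReal (A * ‖f x‖ ^ 2) *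
          (if ‖f x‖ ≤ s then ENNReal.ofReal (s ^ (q - 3)) else 0) := by
    have hm := mul_count_lt_le (fun x => ‖zconv R K fl x‖ₑ ^ (2 : ℝ))
      (ENNReal.ofReal (2 * s) ^ (2 : ℝ))
    have hset : {x | ENNReal.ofReal (2 * s) ^ (2 : ℝ) < ‖zconv R K fl x‖ₑ ^ (2 : ℝ)} = S2 := by
      ext x
      exact ENNReal.rpow_lt_rpow_iff two_pos
    rw [hset] at hm
    have hw := hm.trans (hA fl hfls)
    calc Measure.count S2 * ENNReal.ofReal (s ^ (q - 1))
        = (ENNReal.ofReal (s ^ 2) * Measure.count S2) * ENNReal.ofReal (s ^ (q - 3)) := by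
          rw [show q - 1 = (2 : ℕ) + (q - 3) by push_cast; ring, Real.rpow_add hs,
            Real.rpow_natCast, ENNReal.ofReal_mul (by positivity)]
          ring
      _ ≤ (ENNReal.ofReal (2 * s) ^ (2 : ℝ) * Measure.count S2) *
          ENNReal.ofReal (s ^ (q - 3)) := by
          gcongr
          rw [ENNReal.rpow_two, ← ENNReal.ofReal_pow (by positivity)]
          apply ENNReal.ofReal_le_ofReal
          nlinarith
      _ ≤ (ENNReal.ofReal A * ∑' x, ‖fl x‖ₑ ^ (2 : ℝ)) *
          ENNReal.ofReal (s ^ (q - 3)) := mul_le_mul_left hw _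
      _ = _ := by
          rw [← ENNReal.tsum_mul_left, ← ENNReal.tsum_mul_right]
          refine tsum_congr fun x => ?_
          rw [ENNReal.ofReal_mul (by positivity), ENNReal.ofReal_pow (norm_nonneg _), ofReal_norm]
          by_cases h : ‖f x‖ ≤ s <;> simp [hfl, h]
  rw [ENNReal.tsum_add]
  calc _ ≤ (Measure.count S1 + Measure.count S2) * ENNReal.ofReal (s ^ (q - 1)) := by
        gcongr
        exact (measure_mono hsub).trans (measure_union_le _ _)
    _ ≤ _ := by
        rw [add_mul]
        exact add_le_add b1 b2

/-- Layer-cake formula and Tonelli. At each `x` the high weight is integrated over `s < ‖f x‖`,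
which converges because `q > 1`, and the low weight over `s ≥ ‖f x‖`, which converges because `q <
2`; hence the denominators `q - 1` and `2 - q`. -/
theorem lpBound_of_lt_two {R : ℕ} {K : ℤ → ℝ} (hK : ∀ j : ℤ, R < j.natAbs → K j = 0)
    {A H : ℝ} (hA0 : 0 ≤ A) (hA : LpBound E R K 2 A) (hH0 : 0 ≤ H) (hH : HormanderBound K H)
    {q : ℝ} (hq1 : 1 < q) (hq2 : q < 2) :
    LpBound E R K q (4 ^ q * q * ((2 * A + 5 + 2 * H) / (q - 1) + A / (2 - q))) := by
  intro f hf
  set D := 2 * A + 5 + 2 * H with hD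
  have hD0 : 0 ≤ D := by positivity
  have hq0 : 0 < q := by linarith
  have hlc := lintegral_rpow_eq_lintegral_meas_lt_mul (Measure.count : Measure ℤ)
    (f := fun x => ‖zconv R K f x‖ / 4) (ae_of_all _ fun x => by positivity)
    (measurable_of_countable _).aemeasurable hq0
  have hpt : ∀ x : ℤ, ∫⁻ s in Set.Ioi (0 : ℝ), (ENNReal.ofReal (D * ‖f x‖) *
          (if s < ‖f x‖ then ENNReal.ofReal (s ^ (q - 2)) else 0) +
        ENNReal.ofReal (A * ‖f x‖ ^ 2) *
          (if ‖f x‖ ≤ s then ENNReal.ofReal (s ^ (q - 3)) else 0)) ≤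
      ENNReal.ofReal (D / (q - 1) + A / (2 - q)) * ‖f x‖ₑ ^ q := by
    intro x
    rcases eq_or_ne (f x) 0 with h0 | h0
    · simp [h0]
    have hpos : 0 < ‖f x‖ := norm_pos_iff.2 h0
    have hm1 : Measurable fun s : ℝ => if s < ‖f x‖ then ENNReal.ofReal (s ^ (q - 2)) else 0 :=
      Measurable.ite measurableSet_Iio (by fun_prop) measurable_const
    have hm2 : Measurable fun s : ℝ => if ‖f x‖ ≤ s then ENNReal.ofReal (s ^ (q - 3)) else 0 :=
      Measurable.ite measurableSet_Ici (by fun_prop) measurable_const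
    rw [lintegral_add_left (hm1.const_mul _), lintegral_const_mul _ hm1, lintegral_const_mul _ hm2]
    calc _ ≤ ENNReal.ofReal (D * ‖f x‖) *
            ENNReal.ofReal (‖f x‖ ^ (q - 2 + 1) / (q - 2 + 1)) +
          ENNReal.ofReal (A * ‖f x‖ ^ 2) *
            ENNReal.ofReal (‖f x‖ ^ (q - 3 + 1) / (-(q - 3 + 1))) := by
          gcongr
          · exact lintegral_Ioi_ite_lt_rpow hpos (by linarith)
          · exact lintegral_Ioi_ite_le_rpow hpos (by linarith)
      _ = ENNReal.ofReal ((D / (q - 1) + A / (2 - q)) * ‖f x‖ ^ q) := by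
          have e1 : ‖f x‖ ^ q = ‖f x‖ * ‖f x‖ ^ (q - 2 + 1) := by
            rw [← Real.rpow_one_add' hpos.le (by linarith)]
            congr 1
            ring
          have e2 : ‖f x‖ ^ q = ‖f x‖ ^ 2 * ‖f x‖ ^ (q - 3 + 1) := by
            rw [← Real.rpow_natCast, ← Real.rpow_add hpos]
            congr 1
            push_cast
            ring
          have d1 : 0 < q - 2 + 1 := by linarith
          have d2 : 0 < -(q - 3 + 1) := by linarith
          rw [← ENNReal.ofReal_mul (by positivity), ← ENNReal.ofReal_mul (by positivity),
            ← ENNReal.ofReal_add (by positivity) (by positivity),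
            add_mul (D / (q - 1))]
          congr 1
          congr 1
          · rw [e1, show q - 2 + 1 = q - 1 by ring]
            ring
          · rw [e2, show -(q - 3 + 1) = 2 - q by ring]
            ring
      _ = _ := by
          rw [ENNReal.ofReal_mul (add_nonneg (div_nonneg hD0 (by linarith))
            (div_nonneg hA0 (by linarith))), ← ENNReal.ofReal_rpow_of_nonneg hpos.le hq0.le,
            ofReal_norm]
  have main : ∑' x, ENNReal.ofReal ((‖zconv R K f x‖ / 4) ^ q) ≤
      ENNReal.ofReal q * (ENNReal.ofReal (D / (q - 1) + A / (2 - q)) * ∑' x, ‖f x‖ₑ ^ q) := by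
    rw [← lintegral_count, hlc]
    gcongr
    calc _ ≤ ∫⁻ s in Set.Ioi (0 : ℝ), ∑' x, (ENNReal.ofReal (D * ‖f x‖) *
          (if s < ‖f x‖ then ENNReal.ofReal (s ^ (q - 2)) else 0) +
        ENNReal.ofReal (A * ‖f x‖ ^ 2) *
          (if ‖f x‖ ≤ s then ENNReal.ofReal (s ^ (q - 3)) else 0)) := by
          refine setLIntegral_mono' measurableSet_Ioi fun s hs => ?_
          exact count_zconv_lt_le hK hA0 hA hH0 hH hf q hs
      _ = ∑' x, ∫⁻ s in Set.Ioi (0 : ℝ), (ENNReal.ofReal (D * ‖f x‖) *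
          (if s < ‖f x‖ then ENNReal.ofReal (s ^ (q - 2)) else 0) +
        ENNReal.ofReal (A * ‖f x‖ ^ 2) *
          (if ‖f x‖ ≤ s then ENNReal.ofReal (s ^ (q - 3)) else 0)) := by
          refine lintegral_tsum fun x => Measurable.aemeasurable ?_
          exact ((Measurable.ite measurableSet_Iio (by fun_prop) measurable_const).const_mul _).add
            ((Measurable.ite measurableSet_Ici (by fun_prop) measurable_const).const_mul _)
      _ ≤ _ := by
          rw [← ENNReal.tsum_mul_left]
          exact ENNReal.tsum_le_tsum hpt
  calc ∑' x, ‖zconv R K f x‖ₑ ^ q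
      = ENNReal.ofReal (4 ^ q) * ∑' x, ENNReal.ofReal ((‖zconv R K f x‖ / 4) ^ q) := by
        rw [← ENNReal.tsum_mul_left]
        refine tsum_congr fun x => ?_
        rw [← ENNReal.ofReal_mul (by positivity), ← Real.mul_rpow (by positivity) (by positivity),
          mul_div_cancel₀ _ (by norm_num), ← ENNReal.ofReal_rpow_of_nonneg (norm_nonneg _) hq0.le,
          ofReal_norm]
    _ ≤ _ := by
        rw [ENNReal.ofReal_mul (by positivity), ENNReal.ofReal_mul (by positivity), mul_assoc,
          mul_assoc]
        exact mul_le_mul_right main _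

end Marcinkiewicz

/-! ### Duality and the range `q > 2` -/

theorem tsum_enorm_rpow_eq {f : ℤ → ℝ} {U : Finset ℤ} (hf : ∀ x ∉ U, f x = 0) {q : ℝ}
    (hq : 0 < q) : ∑' x, ‖f x‖ₑ ^ q = ENNReal.ofReal (∑ x ∈ U, |f x| ^ q) := by
  rw [tsum_eq_sum (s := U) fun x hx => by simp [hf x hx, hq],
    ENNReal.ofReal_sum_of_nonneg fun _ _ => by positivity]
  refine Finset.sum_congr rfl fun x _ => ?_
  rw [← ENNReal.ofReal_rpow_of_nonneg (abs_nonneg _) hq.le, ← Real.norm_eq_abs, ofReal_norm]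

/-- Duality: an `ℓ^{q'}` bound for the reflected kernel gives an `ℓ^q` bound. -/
theorem LpBound.dual {R : ℕ} {K : ℤ → ℝ} (hK : ∀ j : ℤ, R < j.natAbs → K j = 0)
    {q q' C : ℝ} (hqq : q.HolderConjugate q') (hC : 0 ≤ C)
    (h : LpBound ℝ R (fun x => K (-x)) q' C) : LpBound ℝ R K q (C ^ (q - 1)) := by
  classical
  intro f hf
  have hq := hqq.pos
  have hq' := hqq.symm.pos
  have hTf := zconv_support_finite R K hf
  set u := zconv R K f with hu
  set U := hf.toFinset ∪ hTf.toFinset with hU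
  have hfU : ∀ x ∉ U, f x = 0 := fun x hx => by
    simp only [hU, Finset.mem_union, not_or, Set.Finite.mem_toFinset, Function.mem_support,
      not_not] at hx
    exact hx.1
  have huU : ∀ x ∉ U, u x = 0 := fun x hx => by
    simp only [hU, Finset.mem_union, not_or, Set.Finite.mem_toFinset, Function.mem_support,
      not_not] at hx
    exact hx.2
  -- The extremal function for Hölder's inequality: `u * g = |u| ^ q` and `|g| ^ q' ≤ |u| ^ q`.
  set g : ℤ → ℝ := fun x => SignType.sign (u x) * |u x| ^ (q - 1) with hg
  have hgU : ∀ x ∉ U, g x = 0 := fun x hx => by simp [hg, huU x hx]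
  have hgs : g.support.Finite := U.finite_toSet.subset fun x hx => by
    by_contra hxU
    exact hx (hgU x hxU)
  set w := zconv R (fun x => K (-x)) g with hw
  have hug : ∀ x, u x * g x = |u x| ^ q := by
    intro x
    rcases eq_or_ne (u x) 0 with h0 | h0
    · simp [hg, h0, hq.ne']
    · have : u x * g x = |u x| * |u x| ^ (q - 1) := by
        rw [hg, ← mul_assoc, self_mul_sign]
      rw [this, ← Real.rpow_one_add' (abs_nonneg _) (by linarith)]
      congr 1
      ring
  have hgq : ∀ x, |g x| ^ q' ≤ |u x| ^ q := by
    intro x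
    have h1 : |g x| ≤ |u x| ^ (q - 1) := by
      rw [hg, abs_mul, abs_of_nonneg (Real.rpow_nonneg (abs_nonneg _) _ : 0 ≤ |u x| ^ (q - 1))]
      refine mul_le_of_le_one_left (by positivity) ?_
      rcases lt_trichotomy (u x) 0 with h | h | h <;> simp [h]
    calc |g x| ^ q' ≤ (|u x| ^ (q - 1)) ^ q' := by gcongr
      _ = |u x| ^ q := by rw [← Real.rpow_mul (abs_nonneg _), hqq.sub_one_mul_conj]
  have hdual : ∑ x ∈ U, u x * g x = ∑ y ∈ U, f y * w y := by
    have e1 : ∀ x, u x = ∑ y ∈ U, K (x - y) • f y := fun x => zconv_eq_sum hK hfU x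
    have e2 : ∀ y, w y = ∑ x ∈ U, K (-(y - x)) • g x := fun y =>
      zconv_eq_sum (K := fun x => K (-x)) (fun j hj => hK _ (by simpa using hj)) hgU y
    calc ∑ x ∈ U, u x * g x = ∑ x ∈ U, ∑ y ∈ U, K (x - y) * f y * g x := by
          refine Finset.sum_congr rfl fun x _ => ?_
          rw [e1, Finset.sum_mul]
          simp
      _ = ∑ y ∈ U, ∑ x ∈ U, K (x - y) * f y * g x := Finset.sum_comm
      _ = ∑ y ∈ U, f y * w y := by
          refine Finset.sum_congr rfl fun y _ => ?_
          rw [e2, Finset.mul_sum]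
          refine Finset.sum_congr rfl fun x _ => ?_
          rw [neg_sub, smul_eq_mul]
          ring
  set N := ∑ x ∈ U, |u x| ^ q with hN
  set F := ∑ x ∈ U, |f x| ^ q with hF
  have hN0 : 0 ≤ N := Finset.sum_nonneg fun _ _ => by positivity
  have hF0 : 0 ≤ F := Finset.sum_nonneg fun _ _ => by positivity
  have hwN : ∑ x ∈ U, |w x| ^ q' ≤ C * N := by
    have h1 := h g hgs
    rw [tsum_enorm_rpow_eq hgU hq', ← ENNReal.ofReal_mul hC] at h1
    have h2 : ENNReal.ofReal (∑ x ∈ U, |w x| ^ q') ≤ ∑' x, ‖w x‖ₑ ^ q' := by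
      refine le_trans (le_of_eq ?_) (ENNReal.sum_le_tsum U)
      rw [ENNReal.ofReal_sum_of_nonneg fun _ _ => by positivity]
      refine Finset.sum_congr rfl fun x _ => ?_
      rw [← ENNReal.ofReal_rpow_of_nonneg (abs_nonneg _) hq'.le, ← Real.norm_eq_abs, ofReal_norm]
    have hG : ∑ x ∈ U, |g x| ^ q' ≤ N := Finset.sum_le_sum fun x _ => hgq x
    have h3 := (ENNReal.ofReal_le_ofReal_iff (mul_nonneg hC
      (Finset.sum_nonneg fun _ _ => by positivity))).1 (h2.trans h1)
    exact h3.trans (mul_le_mul_of_nonneg_left hG hC)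
  have hmain : N ≤ F ^ (1 / q) * (C * N) ^ (1 / q') := by
    calc N = ∑ y ∈ U, f y * w y := by
          rw [← hdual]
          exact Finset.sum_congr rfl fun x _ => (hug x).symm
      _ ≤ F ^ (1 / q) * (∑ y ∈ U, |w y| ^ q') ^ (1 / q') :=
          Real.inner_le_Lp_mul_Lq U f w hqq
      _ ≤ _ := by gcongr
  have hfinal : N ≤ C ^ (q - 1) * F := by
    rcases hN0.eq_or_lt with h0 | hpos
    · rw [← h0]
      positivity
    -- Hölder raised to the power `q`, with `q / q' = q - 1`; the factor `N ^ (q - 1)` is then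
    -- cancelled.
    have e : N ^ q ≤ F * (C ^ (q - 1) * N ^ (q - 1)) := by
      calc N ^ q ≤ (F ^ (1 / q) * (C * N) ^ (1 / q')) ^ q := by gcongr
        _ = _ := by
          rw [Real.mul_rpow (by positivity) (by positivity), ← Real.rpow_mul hF0,
            one_div_mul_cancel hq.ne', Real.rpow_one, ← Real.rpow_mul (by positivity),
            one_div_mul_eq_div, hqq.div_conj_eq_sub_one,
            Real.mul_rpow hC hN0]
    have e2 : N ^ q = N * N ^ (q - 1) := by
      rw [← Real.rpow_one_add' hN0 (by linarith)]
      congr 1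
      ring
    rw [e2, ← mul_assoc] at e
    have := le_of_mul_le_mul_right e (Real.rpow_pos_of_pos hpos _)
    linarith
  rw [tsum_enorm_rpow_eq huU hq, tsum_enorm_rpow_eq hfU hq,
    ← ENNReal.ofReal_mul (by positivity)]
  exact ENNReal.ofReal_le_ofReal hfinal

theorem HormanderBound.reflect {K : ℤ → ℝ} {H : ℝ} (h : HormanderBound K H) :
    HormanderBound (fun x => K (-x)) H := by
  intro y
  refine le_trans (le_of_eq ?_) (h (-y))
  rw [← (Equiv.neg ℤ).tsum_eq]
  refine tsum_congr fun x => ?_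
  simp only [Equiv.neg_apply, Int.natAbs_neg, neg_sub, neg_neg]
  rw [show y - -x = x - -y by ring]

/-- Calderón–Zygmund operators on `ℤ` are bounded on `ℓ^q` for all `1 < q < ∞`, with a constant
depending only on the `ℓ²` bound, the Hörmander bound and `q`. -/
theorem exists_lpBound {A H q : ℝ} (hA0 : 0 ≤ A) (hH0 : 0 ≤ H) (hq : 1 < q) :
    ∃ C : ℝ, 0 ≤ C ∧ ∀ (R : ℕ) (K : ℤ → ℝ), (∀ j : ℤ, R < j.natAbs → K j = 0) →
      LpBound ℝ R K 2 A → HormanderBound K H → LpBound ℝ R K q C := by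
  have hC0 : ∀ q' : ℝ, 1 < q' → q' < 2 →
      0 ≤ 4 ^ q' * q' * ((2 * A + 5 + 2 * H) / (q' - 1) + A / (2 - q')) := by
    intro q' h1 h2
    have : 0 < q' - 1 := by linarith
    have : 0 < 2 - q' := by linarith
    have : 0 < q' := by linarith
    positivity
  rcases lt_trichotomy q 2 with h | h | h
  · exact ⟨_, hC0 q hq h, fun R K hK hA hH => lpBound_of_lt_two hK hA0 hA hH0 hH hq h⟩
  · subst h
    exact ⟨A, hA0, fun R K hK hA hH => hA⟩
  · have hqq : q.HolderConjugate (q / (q - 1)) := Real.HolderConjugate.conjExponent hq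
    have h1 : 1 < q / (q - 1) := hqq.symm.lt
    have h2 : q / (q - 1) < 2 := by
      rw [div_lt_iff₀ (by linarith)]
      linarith
    have hc := hC0 _ h1 h2
    set c := 4 ^ (q / (q - 1)) * (q / (q - 1)) *
      ((2 * A + 5 + 2 * H) / (q / (q - 1) - 1) + A / (2 - q / (q - 1))) with hcdef
    refine ⟨c ^ (q - 1), Real.rpow_nonneg hc _, fun R K hK hA hH => ?_⟩
    refine LpBound.dual hK hqq hc ?_
    have hK' : ∀ j : ℤ, R < j.natAbs → K (-j) = 0 := fun j hj => hK _ (by simpa using hj)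
    -- Self-duality at exponent `2` moves the bound to the reflected kernel, with constant `A ^ (2 -
    -- 1) = A`.
    have hA' : LpBound ℝ R (fun x => K (-x)) 2 A := by
      have := LpBound.dual (K := fun x => K (-x)) hK' Real.HolderConjugate.two_two hA0 (by simpa using hA)
      simpa [show (2 : ℝ) - 1 = 1 by norm_num] using this
    exact lpBound_of_lt_two hK' hA0 hA' hH0 hH.reflect h1 h2

/-! ### Geometric sums along a lacunary sequence -/

section Lacunary

/-- The constant `c = r / (r - 1)` solves `1 + c / r = c`. The minimum makes the induction close:
while `n M < t` the first term vanishes and the bound stays `c`; afterwards each step gains a factor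
`1 / r`. -/
theorem sum_lacunary_tail_le {r : ℝ} (hr : 1 < r) {n : ℕ → ℕ} (hn0 : ∀ k, 0 < n k)
    (hn : ∀ k, r * (n k : ℝ) ≤ (n (k + 1) : ℝ)) {t : ℝ} (ht : 0 ≤ t) (N : ℕ) :
    ∀ M, ∑ k ∈ Finset.range N, (if t ≤ n (M + k) then t / n (M + k) else 0) ≤
      r / (r - 1) * min 1 (t / n M) := by
  have hr1 : 0 < r - 1 := by linarith
  have hc : 0 < r / (r - 1) := by positivity
  have hcr : 1 + r / (r - 1) / r = r / (r - 1) := by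
    field_simp
    ring
  induction N with
  | zero =>
    intro M
    simp only [Finset.range_zero, Finset.sum_empty]
    positivity
  | succ N ih =>
    intro M
    rw [Finset.sum_range_succ']
    have h1 : ∑ k ∈ Finset.range N, (if t ≤ n (M + (k + 1)) then t / n (M + (k + 1)) else 0) ≤
        r / (r - 1) * min 1 (t / n (M + 1)) := by
      refine (le_of_eq (Finset.sum_congr rfl fun k _ => ?_)).trans (ih (M + 1))
      rw [show M + (k + 1) = M + 1 + k by ring]
    have hM : (0 : ℝ) < n M := by exact_mod_cast hn0 M
    have hM1 : (0 : ℝ) < n (M + 1) := by exact_mod_cast hn0 (M + 1)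
    rw [add_zero]
    by_cases h : t ≤ n M
    · rw [if_pos h, min_eq_right ((div_le_one hM).2 h)]
      have h2 : t / n (M + 1) ≤ t / n M / r := by
        rw [div_div, mul_comm]
        exact div_le_div_of_nonneg_left ht (by positivity) (hn M)
      calc _ ≤ r / (r - 1) * (t / n M / r) + t / n M := by
            gcongr
            exact h1.trans (mul_le_mul_of_nonneg_left ((min_le_right _ _).trans h2) hc.le)
        _ = (1 + r / (r - 1) / r) * (t / n M) := by ring
        _ = _ := by rw [hcr]
    · rw [if_neg h, add_zero, min_eq_left ((one_le_div hM).2 (not_le.1 h).le)]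
      exact h1.trans (mul_le_mul_of_nonneg_left (min_le_left _ _) hc.le)

/-- The mirror image of the tail estimate: the terms up to `t` grow geometrically, so the last one
dominates. -/
theorem sum_lacunary_head_le {r : ℝ} (hr : 1 < r) {n : ℕ → ℕ}
    (hn : ∀ k, r * (n k : ℝ) ≤ (n (k + 1) : ℝ)) {t : ℝ} (ht : 0 ≤ t) (N : ℕ) :
    ∑ k ∈ Finset.range (N + 1), (if (n k : ℝ) ≤ t then (n k : ℝ) else 0) ≤
      r / (r - 1) * min t (n N) := by
  have hr1 : 0 < r - 1 := by linarith
  have hc : 0 < r / (r - 1) := by positivity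
  have hcr : 1 + r / (r - 1) / r = r / (r - 1) := by
    field_simp
    ring
  have hc1 : 1 ≤ r / (r - 1) := by
    rw [one_le_div hr1]
    linarith
  induction N with
  | zero =>
    have : (0 : ℝ) ≤ n 0 := Nat.cast_nonneg _
    rw [zero_add, Finset.sum_range_one]
    split_ifs with h
    · rw [min_eq_right h]
      nlinarith
    · positivity
  | succ N ih =>
    rw [Finset.sum_range_succ]
    by_cases h : (n (N + 1) : ℝ) ≤ t
    · rw [if_pos h, min_eq_right h]
      have h2 : (n N : ℝ) ≤ n (N + 1) / r := by
        rw [le_div_iff₀ (by linarith)]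
        linarith [hn N]
      calc _ ≤ r / (r - 1) * (n (N + 1) / r) + n (N + 1) := by
            gcongr
            exact ih.trans (mul_le_mul_of_nonneg_left ((min_le_right _ _).trans h2) hc.le)
        _ = (1 + r / (r - 1) / r) * n (N + 1) := by ring
        _ = _ := by rw [hcr]
    · rw [if_neg h, add_zero, min_eq_left (not_le.1 h).le]
      exact ih.trans (mul_le_mul_of_nonneg_left (min_le_left _ _) hc.le)

theorem exists_subset_range_succ (S : Finset ℕ) : ∃ N, S ⊆ Finset.range (N + 1) :=
  ⟨S.sup id, fun _ hk => Finset.mem_range_succ_iff.2 (Finset.le_sup (f := id) hk)⟩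

theorem sum_finset_lacunary_tail_le {r : ℝ} (hr : 1 < r) {n : ℕ → ℕ} (hn0 : ∀ k, 0 < n k)
    (hn : ∀ k, r * (n k : ℝ) ≤ (n (k + 1) : ℝ)) {t : ℝ} (ht : 0 ≤ t) (S : Finset ℕ) :
    ∑ k ∈ S, (if t ≤ n k then t / n k else 0) ≤ r / (r - 1) := by
  obtain ⟨N, hN⟩ := exists_subset_range_succ S
  have h := sum_lacunary_tail_le hr hn0 hn ht (N + 1) 0
  simp only [zero_add] at h
  refine (Finset.sum_le_sum_of_subset_of_nonneg hN fun k _ _ => ?_).trans (h.trans ?_)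
  · split_ifs <;> positivity
  · exact mul_le_of_le_one_right (div_nonneg (by linarith) (by linarith)) (min_le_left _ _)

theorem sum_finset_lacunary_head_le {r : ℝ} (hr : 1 < r) {n : ℕ → ℕ}
    (hn : ∀ k, r * (n k : ℝ) ≤ (n (k + 1) : ℝ)) {t : ℝ} (ht : 0 < t) (S : Finset ℕ) :
    ∑ k ∈ S, (if (n k : ℝ) ≤ t then (n k : ℝ) / t else 0) ≤ r / (r - 1) := by
  obtain ⟨N, hN⟩ := exists_subset_range_succ S
  have h := (sum_lacunary_head_le hr hn ht.le N).trans (mul_le_mul_of_nonneg_left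
    (min_le_left t (n N)) (div_nonneg (by linarith) (by linarith)))
  refine (Finset.sum_le_sum_of_subset_of_nonneg hN fun k _ _ => ?_).trans ?_
  · split_ifs <;> positivity
  · rw [← div_le_iff₀ ht, Finset.sum_div] at h
    refine le_trans (le_of_eq (Finset.sum_congr rfl fun k _ => ?_)) h
    split_ifs <;> simp

end Lacunary

/-! ### Averaging kernels and Hörmander's condition -/

/-- The kernel of the forward average `f ↦ (1 / n) ∑_{j = 1}^n f (· + j)` on `ℤ`. -/
noncomputable def avgKernel (n : ℕ) (x : ℤ) : ℝ :=
  if -(n : ℤ) ≤ x ∧ x ≤ -1 then (n : ℝ)⁻¹ else 0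

/-- The kernel of a finite subseries of differences of averages. -/
noncomputable def diffKernel (n : ℕ → ℕ) (S : Finset ℕ) (x : ℤ) : ℝ :=
  ∑ k ∈ S, (avgKernel (n (k + 1)) x - avgKernel (n k) x)

/-- The kernel is a step function that jumps only at the ends of `[-n, -1]`. A shift by `y` alters
it only near these jumps. The jump near `0` lies in the excluded range `|x| ≤ 2 * |y|`; the one near
`-n` affects at most `2 * |y|` points, by `1 / n` each. If `|y| > n`, both `x` and `x - y` miss the
support. -/
theorem tsum_avgKernel_sub_le (n : ℕ) (y : ℤ) :
    ∑' x : ℤ, (if x.natAbs ≤ 2 * y.natAbs then 0 else ‖avgKernel n (x - y) - avgKernel n x‖ₑ) ≤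
      ENNReal.ofReal (2 * if (y.natAbs : ℝ) ≤ n then (y.natAbs : ℝ) / n else 0) := by
  set t := y.natAbs with ht
  by_cases h : (t : ℝ) ≤ n
  · have h' : t ≤ n := by exact_mod_cast h
    rw [if_pos h]
    set V := Finset.Ico (-(n : ℤ) - t) (-(n : ℤ) + t) with hV
    rw [tsum_eq_sum (s := V)]
    · calc _ ≤ ∑ x ∈ V, ENNReal.ofReal (n : ℝ)⁻¹ := by
            refine Finset.sum_le_sum fun x _ => ?_
            split_ifs with hx
            · exact bot_le
            · rw [← ofReal_norm]
              apply ENNReal.ofReal_le_ofReal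
              have : (0 : ℝ) ≤ (n : ℝ)⁻¹ := by positivity
              unfold avgKernel
              split_ifs <;> simp [this]
        _ = _ := by
            rw [Finset.sum_const, nsmul_eq_mul, hV, Int.card_Ico,
              show (-(n : ℤ) + t - (-(n : ℤ) - t)).toNat = 2 * t by omega,
              ← ENNReal.ofReal_natCast, ← ENNReal.ofReal_mul (by positivity)]
            push_cast
            congr 1
            ring
    · intro x hx
      by_cases h2 : x.natAbs ≤ 2 * t
      · rw [if_pos h2]
      · rw [if_neg h2]
        have : avgKernel n (x - y) = avgKernel n x := by
          unfold avgKernel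
          rw [hV, Finset.mem_Ico] at hx
          congr 1
          apply propext
          omega
        simp [this]
  · rw [if_neg h]
    have h' : n < t := by
      rw [not_le] at h
      exact_mod_cast h
    simp only [mul_zero, ENNReal.ofReal_zero, nonpos_iff_eq_zero, ENNReal.tsum_eq_zero]
    intro x
    by_cases h2 : x.natAbs ≤ 2 * t
    · rw [if_pos h2]
    · have h3 : ¬ (-(n : ℤ) ≤ x ∧ x ≤ -1) := by omega
      have h4 : ¬ (-(n : ℤ) ≤ x - y ∧ x - y ≤ -1) := by omega
      rw [if_neg h2, avgKernel, avgKernel, if_neg h3, if_neg h4, sub_zero, enorm_zero]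

theorem hormanderBound_diffKernel {r : ℝ} (hr : 1 < r) {n : ℕ → ℕ} (hn0 : ∀ k, 0 < n k)
    (hn : ∀ k, r * (n k : ℝ) ≤ (n (k + 1) : ℝ)) (S : Finset ℕ) :
    HormanderBound (diffKernel n S) (4 * (r / (r - 1))) := by
  intro y
  have hpt : ∀ x : ℤ, (if x.natAbs ≤ 2 * y.natAbs then 0 else
      ‖diffKernel n S (x - y) - diffKernel n S x‖ₑ) ≤
      ∑ k ∈ S, ((if x.natAbs ≤ 2 * y.natAbs then 0 else
        ‖avgKernel (n (k + 1)) (x - y) - avgKernel (n (k + 1)) x‖ₑ) +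
        (if x.natAbs ≤ 2 * y.natAbs then 0 else
        ‖avgKernel (n k) (x - y) - avgKernel (n k) x‖ₑ)) := by
    intro x
    by_cases h : x.natAbs ≤ 2 * y.natAbs
    · simp [h]
    · simp only [h, if_false]
      rw [diffKernel, diffKernel, ← Finset.sum_sub_distrib]
      refine (enorm_sum_le _ _).trans (Finset.sum_le_sum fun k _ => ?_)
      rw [sub_sub_sub_comm]
      exact enorm_sub_le
  refine (ENNReal.tsum_le_tsum hpt).trans ?_
  rw [Summable.tsum_finsetSum fun _ _ => ENNReal.summable]
  have ht : (0 : ℝ) ≤ y.natAbs := Nat.cast_nonneg _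
  have nn : ∀ m : ℕ, 0 ≤ 2 * if (y.natAbs : ℝ) ≤ m then (y.natAbs : ℝ) / m else 0 := by
    intro m
    split_ifs <;> positivity
  calc _ ≤ ∑ k ∈ S, (ENNReal.ofReal ((2 * if (y.natAbs : ℝ) ≤ n (k + 1) then
            (y.natAbs : ℝ) / n (k + 1) else 0) + 2 * if (y.natAbs : ℝ) ≤ n k then
            (y.natAbs : ℝ) / n k else 0)) := by
        refine Finset.sum_le_sum fun k _ => ?_
        rw [ENNReal.tsum_add, ENNReal.ofReal_add (nn _) (nn _)]
        exact add_le_add (tsum_avgKernel_sub_le _ _) (tsum_avgKernel_sub_le _ _)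
    _ ≤ _ := by
        rw [← ENNReal.ofReal_sum_of_nonneg fun k _ => add_nonneg (nn _) (nn _)]
        apply ENNReal.ofReal_le_ofReal
        rw [Finset.sum_add_distrib, ← Finset.mul_sum, ← Finset.mul_sum]
        have h1 := sum_finset_lacunary_tail_le hr hn0 hn ht S
        have h2 := sum_finset_lacunary_tail_le hr (n := fun k => n (k + 1)) (fun k => hn0 _)
          (fun k => hn _) ht S
        linarith

/-! ### Fourier multipliers and the `ℓ²` bound -/

section Fourier

theorem norm_sq_sum_fourierLp (f : ℤ → ℝ) (U : Finset ℤ) :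
    ‖∑ x ∈ U, (f x : ℂ) • fourierLp (T := 1) 2 x‖ ^ 2 = ∑ x ∈ U, |f x| ^ 2 := by
  have h := (orthonormal_fourier (T := 1)).inner_sum (fun x => (f x : ℂ)) (fun x => (f x : ℂ)) U
  rw [inner_self_eq_norm_sq_to_K] at h
  have h2 : ∀ x ∈ U, (starRingEnd ℂ) (f x : ℂ) * (f x : ℂ) = ((|f x| ^ 2 : ℝ) : ℂ) := by
    intro x _
    rw [Complex.conj_ofReal, sq_abs]
    push_cast
    ring
  rw [Finset.sum_congr rfl h2, ← Complex.ofReal_sum] at h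
  exact Complex.ofReal_injective (by simpa using h)

/-- Parseval: the trigonometric polynomial of `zconv R K f` is that of `f` times the symbol of `K`.
-/
theorem lpBound_two_of_fourier {R : ℕ} {K : ℤ → ℝ} {M : ℝ}
    (hM : ∀ t : AddCircle (1 : ℝ), ‖∑ j ∈ Finset.Icc (-R : ℤ) R, (K j : ℂ) * fourier j t‖ ≤ M) :
    LpBound ℝ R K 2 (M ^ 2) := by
  classical
  intro f hf
  set U := hf.toFinset with hU
  have hfU : ∀ x ∉ U, f x = 0 := fun x hx => by simpa [hU] using hx
  set V := Finset.image₂ (fun a b => a + b) U (Finset.Icc (-R : ℤ) R) with hV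
  have hTV : ∀ x ∉ V, zconv R K f x = 0 := by
    intro x hx
    refine Finset.sum_eq_zero fun j hj => ?_
    rw [hfU (x - j), smul_zero]
    intro hmem
    exact hx (Finset.mem_image₂.2 ⟨x - j, hmem, j, hj, by ring⟩)
  set u : C(AddCircle (1 : ℝ), ℂ) := ∑ x ∈ V, ((zconv R K f x : ℝ) : ℂ) • fourier x with hu
  set v : C(AddCircle (1 : ℝ), ℂ) := ∑ x ∈ U, (f x : ℂ) • fourier x with hv
  have hpt : ∀ t, u t = (∑ j ∈ Finset.Icc (-R : ℤ) R, (K j : ℂ) * fourier j t) * v t := by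
    intro t
    have hshift : ∀ j ∈ Finset.Icc (-R : ℤ) R, ∑ x ∈ V, (f (x - j) : ℂ) * fourier x t =
        ∑ y ∈ U, (f y : ℂ) * fourier (y + j) t := by
      intro j hj
      have e1 : ∑ x ∈ V, (f (x - j) : ℂ) * fourier x t =
          ∑' x, (f (x - j) : ℂ) * fourier x t := by
        rw [tsum_eq_sum]
        intro x hx
        rw [hfU (x - j), Complex.ofReal_zero, zero_mul]
        intro hmem
        exact hx (Finset.mem_image₂.2 ⟨x - j, hmem, j, hj, by ring⟩)
      rw [e1, ← (Equiv.addRight j).tsum_eq, tsum_eq_sum (s := U)]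
      · simp
      · intro y hy
        simp [hfU y hy]
    calc u t = ∑ x ∈ V, ((zconv R K f x : ℝ) : ℂ) * fourier x t := by
          simp [hu, ContinuousMap.sum_apply]
      _ = ∑ x ∈ V, ∑ j ∈ Finset.Icc (-R : ℤ) R, (K j : ℂ) * ((f (x - j) : ℂ) * fourier x t) := by
          refine Finset.sum_congr rfl fun x _ => ?_
          simp only [zconv, smul_eq_mul, Complex.ofReal_sum, Complex.ofReal_mul, Finset.sum_mul]
          exact Finset.sum_congr rfl fun j _ => by ring
      _ = ∑ j ∈ Finset.Icc (-R : ℤ) R, (K j : ℂ) * ∑ x ∈ V, (f (x - j) : ℂ) * fourier x t := by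
          rw [Finset.sum_comm]
          simp only [Finset.mul_sum]
      _ = ∑ j ∈ Finset.Icc (-R : ℤ) R, (K j : ℂ) * (fourier j t * v t) := by
          refine Finset.sum_congr rfl fun j hj => ?_
          rw [hshift j hj, hv, ContinuousMap.sum_apply, Finset.mul_sum, Finset.mul_sum,
            Finset.mul_sum]
          refine Finset.sum_congr rfl fun y _ => ?_
          rw [fourier_add, ContinuousMap.smul_apply, smul_eq_mul]
          ring
      _ = _ := by
          rw [Finset.sum_mul]
          exact Finset.sum_congr rfl fun j _ => by ring
  have htoLp : ∀ (g : ℤ → ℝ) (W : Finset ℤ), ∑ x ∈ W, (g x : ℂ) • fourierLp (T := 1) 2 x =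
      ContinuousMap.toLp (E := ℂ) 2 AddCircle.haarAddCircle ℂ
        (∑ x ∈ W, (g x : ℂ) • fourier x) := by
    intro g W
    simp only [map_sum, map_smul]
  have hnorm : ‖∑ x ∈ V, ((zconv R K f x : ℝ) : ℂ) • fourierLp (T := 1) 2 x‖ ≤
      M * ‖∑ x ∈ U, (f x : ℂ) • fourierLp (T := 1) 2 x‖ := by
    rw [htoLp, htoLp, ← hu, ← hv]
    refine Lp.norm_le_mul_norm_of_ae_le_mul ?_
    filter_upwards [ContinuousMap.coeFn_toLp (p := 2) (𝕜 := ℂ)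
      (AddCircle.haarAddCircle (T := (1 : ℝ))) u, ContinuousMap.coeFn_toLp (p := 2) (𝕜 := ℂ)
      (AddCircle.haarAddCircle (T := (1 : ℝ))) v] with t h1 h2
    rw [h1, h2, hpt, norm_mul]
    gcongr
    exact hM t
  have hsq := pow_le_pow_left₀ (norm_nonneg _) hnorm 2
  rw [mul_pow, norm_sq_sum_fourierLp, norm_sq_sum_fourierLp] at hsq
  rw [tsum_enorm_rpow_eq hTV two_pos, tsum_enorm_rpow_eq hfU two_pos,
    ← ENNReal.ofReal_mul (by positivity)]
  apply ENNReal.ofReal_le_ofReal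
  simpa only [Real.rpow_two] using hsq

/-- The symbol of the average of length `n`. -/
noncomputable def avgSymbol (n : ℕ) (w : ℂ) : ℂ := (n : ℂ)⁻¹ * ∑ i ∈ Finset.range n, w ^ (i + 1)

theorem sum_avgKernel_fourier {n R : ℕ} (hnR : n ≤ R) (t : AddCircle (1 : ℝ)) :
    ∑ j ∈ Finset.Icc (-R : ℤ) R, (avgKernel n j : ℂ) * fourier j t =
      avgSymbol n (fourier (-1) t) := by
  rw [avgSymbol, Finset.mul_sum]
  symm
  refine Finset.sum_of_injOn (fun i : ℕ => -((i : ℤ) + 1)) ?_ ?_ ?_ ?_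
  · intro a _ b _ h
    simp only at h
    omega
  · intro i hi
    simp only [Finset.coe_range, Set.mem_Iio] at hi
    simp only [Finset.coe_Icc, Set.mem_Icc]
    omega
  · intro j _ hj
    have : ¬ (-(n : ℤ) ≤ j ∧ j ≤ -1) := by
      rintro ⟨h1, h2⟩
      apply hj
      refine ⟨(-j - 1).toNat, ?_, ?_⟩
      · simp only [Finset.coe_range, Set.mem_Iio]
        omega
      · simp only
        omega
    rw [avgKernel, if_neg this, Complex.ofReal_zero, zero_mul]
  · intro i hi
    rw [Finset.mem_range] at hi
    have h1 : -(n : ℤ) ≤ -((i : ℤ) + 1) ∧ -((i : ℤ) + 1) ≤ -1 := by omega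
    have h2 : (fourier (-1) t : ℂ) ^ (i + 1) = fourier (-((i : ℤ) + 1)) t := by
      rw [fourier_apply, fourier_apply, ← Circle.coe_pow, ← AddCircle.toCircle_nsmul]
      congr 2
      rw [← natCast_zsmul, smul_smul]
      congr 1
      push_cast
      ring
    rw [avgKernel, if_pos h1, h2, Complex.ofReal_inv, Complex.ofReal_natCast]

theorem norm_pow_sub_one_le {w : ℂ} (hw : ‖w‖ = 1) (i : ℕ) : ‖w ^ i - 1‖ ≤ i * ‖w - 1‖ := by
  induction i with
  | zero => simp
  | succ i ih =>
    calc ‖w ^ (i + 1) - 1‖ = ‖w * (w ^ i - 1) + (w - 1)‖ := by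
          congr 1
          ring
      _ ≤ ‖w‖ * ‖w ^ i - 1‖ + ‖w - 1‖ := (norm_add_le _ _).trans (by rw [norm_mul])
      _ ≤ _ := by
          rw [hw]
          push_cast
          linarith

theorem norm_avgSymbol_sub_one_le {n : ℕ} (hn : 0 < n) {w : ℂ} (hw : ‖w‖ = 1) :
    ‖avgSymbol n w - 1‖ ≤ n * ‖w - 1‖ := by
  have hn' : (n : ℂ) ≠ 0 := by exact_mod_cast hn.ne'
  have hn'' : (0 : ℝ) < n := by exact_mod_cast hn
  have e : avgSymbol n w - 1 = (n : ℂ)⁻¹ * ∑ i ∈ Finset.range n, (w ^ (i + 1) - 1) := by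
    rw [Finset.sum_sub_distrib, mul_sub, avgSymbol]
    simp [hn']
  rw [e, norm_mul, norm_inv, Complex.norm_natCast]
  calc _ ≤ (n : ℝ)⁻¹ * ∑ i ∈ Finset.range n, (n : ℝ) * ‖w - 1‖ := by
        gcongr
        refine (norm_sum_le _ _).trans (Finset.sum_le_sum fun i hi => ?_)
        refine (norm_pow_sub_one_le hw (i + 1)).trans ?_
        gcongr
        exact Finset.mem_range.1 hi
    _ = _ := by
        rw [Finset.sum_const, Finset.card_range, nsmul_eq_mul, inv_mul_cancel_left₀ hn''.ne']

/-- Summing the geometric progression gives decay once `n` exceeds `1 / |w - 1|`; this complements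
`norm_avgSymbol_sub_one_le`, which is useful for smaller `n`. -/
theorem norm_avgSymbol_le {n : ℕ} {w : ℂ} (hw : ‖w‖ = 1) (hw1 : w ≠ 1) :
    ‖avgSymbol n w‖ ≤ 2 * ((n : ℝ)⁻¹ / ‖w - 1‖) := by
  have h0 : 0 < ‖w - 1‖ := norm_pos_iff.2 (sub_ne_zero.2 hw1)
  have e : (w - 1) * avgSymbol n w = (n : ℂ)⁻¹ * (w * (w ^ n - 1)) := by
    have := mul_geom_sum w n
    rw [avgSymbol, ← this, Finset.mul_sum, Finset.mul_sum, Finset.mul_sum, Finset.mul_sum,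
      Finset.mul_sum]
    exact Finset.sum_congr rfl fun i _ => by ring
  have e2 := congrArg norm e
  rw [norm_mul, norm_mul, norm_mul, norm_inv, Complex.norm_natCast, hw, one_mul] at e2
  have h2 : ‖w ^ n - 1‖ ≤ 2 := by
    refine (norm_sub_le _ _).trans ?_
    rw [norm_pow, hw]
    norm_num
  rw [← mul_div_assoc, le_div_iff₀ h0, mul_comm, e2, mul_comm]
  gcongr

/-- With `t = 1 / |w - 1|`, the symbol is compared to the cutoff `χ` of `m ≤ t`. The errors `φ` sum
to at most `3 * (r / (r - 1))` along each of the two sequences `n k` and `n (k + 1)`; the cutoff is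
decreasing along `n`, so its total variation is at most `1`. -/
theorem sum_norm_avgSymbol_sub_le {r : ℝ} (hr : 1 < r) {n : ℕ → ℕ} (hn0 : ∀ k, 0 < n k)
    (hn : ∀ k, r * (n k : ℝ) ≤ (n (k + 1) : ℝ)) (S : Finset ℕ) {w : ℂ} (hw : ‖w‖ = 1) :
    ∑ k ∈ S, ‖avgSymbol (n (k + 1)) w - avgSymbol (n k) w‖ ≤ 6 * (r / (r - 1)) + 1 := by
  have hc : 0 ≤ r / (r - 1) := div_nonneg (by linarith) (by linarith)
  rcases eq_or_ne w 1 with rfl | hw1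
  · have : ∀ m : ℕ, 0 < m → avgSymbol m 1 = 1 := by
      intro m hm
      have : (m : ℂ) ≠ 0 := by exact_mod_cast hm.ne'
      simp [avgSymbol, this]
    simp only [this _ (hn0 _), sub_self, norm_zero, Finset.sum_const_zero]
    positivity
  set t := ‖w - 1‖⁻¹ with ht
  have h0 : 0 < ‖w - 1‖ := norm_pos_iff.2 (sub_ne_zero.2 hw1)
  have ht0 : 0 < t := inv_pos.2 h0
  set χ : ℕ → ℝ := fun m => if (m : ℝ) ≤ t then 1 else 0 with hχ
  set φ : ℕ → ℝ := fun m => (if (m : ℝ) ≤ t then (m : ℝ) / t else 0) +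
    2 * (if t ≤ (m : ℝ) then t / m else 0) with hφ
  have hφb : ∀ m : ℕ, 0 < m → ‖avgSymbol m w - (χ m : ℂ)‖ ≤ φ m := by
    intro m hm
    have hm' : (0 : ℝ) < m := by exact_mod_cast hm
    by_cases h : (m : ℝ) ≤ t
    · have h1 : 0 ≤ 2 * (if t ≤ (m : ℝ) then t / m else 0) := by
        split_ifs <;> positivity
      have h2 := norm_avgSymbol_sub_one_le hm hw
      have h3 : (m : ℝ) * ‖w - 1‖ = m / t := by rw [ht, div_inv_eq_mul]
      simp only [hχ, hφ, h, if_true, Complex.ofReal_one]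
      linarith
    · have h2 := norm_avgSymbol_le (n := m) hw hw1
      have h3 : (m : ℝ)⁻¹ / ‖w - 1‖ = t / m := by
        rw [ht]
        field_simp
      rw [h3] at h2
      simpa [hχ, hφ, h, (not_le.1 h).le] using h2
  have hφs : ∀ n' : ℕ → ℕ, (∀ k, 0 < n' k) → (∀ k, r * (n' k : ℝ) ≤ (n' (k + 1) : ℝ)) →
      ∑ k ∈ S, φ (n' k) ≤ 3 * (r / (r - 1)) := by
    intro n' h1 h2
    simp only [hφ, Finset.sum_add_distrib, ← Finset.mul_sum]
    linarith [sum_finset_lacunary_tail_le hr h1 h2 ht0.le S,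
      sum_finset_lacunary_head_le hr h2 ht0 S]
  have hmono : ∀ k, χ (n (k + 1)) ≤ χ (n k) := by
    intro k
    have h1 : (n k : ℝ) ≤ n (k + 1) := by
      have : (0 : ℝ) ≤ n k := Nat.cast_nonneg _
      nlinarith [hn k]
    simp only [hχ]
    split_ifs with a b
    · exact le_rfl
    · exact absurd (h1.trans a) b
    · exact zero_le_one
    · exact le_rfl
  have hχs : ∑ k ∈ S, (χ (n k) - χ (n (k + 1))) ≤ 1 := by
    obtain ⟨N, hN⟩ := exists_subset_range_succ S
    refine (Finset.sum_le_sum_of_subset_of_nonneg hN fun k _ _ =>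
      sub_nonneg.2 (hmono k)).trans ?_
    rw [Finset.sum_range_sub']
    simp only [hχ]
    split_ifs <;> norm_num
  calc _ ≤ ∑ k ∈ S, (φ (n (k + 1)) + φ (n k) + (χ (n k) - χ (n (k + 1)))) := by
        refine Finset.sum_le_sum fun k _ => ?_
        have e : avgSymbol (n (k + 1)) w - avgSymbol (n k) w =
            (avgSymbol (n (k + 1)) w - (χ (n (k + 1)) : ℂ)) - (avgSymbol (n k) w - (χ (n k) : ℂ)) -
              ((χ (n k) - χ (n (k + 1)) : ℝ) : ℂ) := by
          push_cast
          ring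
        rw [e]
        refine (norm_sub_le _ _).trans (add_le_add ((norm_sub_le _ _).trans
          (add_le_add (hφb _ (hn0 _)) (hφb _ (hn0 _)))) ?_)
        rw [Complex.norm_real, Real.norm_of_nonneg (sub_nonneg.2 (hmono k))]
    _ ≤ _ := by
        rw [Finset.sum_add_distrib, Finset.sum_add_distrib]
        linarith [hφs n hn0 hn, hφs (fun k => n (k + 1)) (fun k => hn0 _) (fun k => hn _)]

end Fourier

/-! ### Uniform `ℓ^q` bounds for the difference kernels -/

theorem lpBound_two_diffKernel {r : ℝ} (hr : 1 < r) {n : ℕ → ℕ} (hn0 : ∀ k, 0 < n k)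
    (hn : ∀ k, r * (n k : ℝ) ≤ (n (k + 1) : ℝ)) (S : Finset ℕ) {R : ℕ}
    (hR : ∀ k ∈ S, n k ≤ R ∧ n (k + 1) ≤ R) :
    LpBound ℝ R (diffKernel n S) 2 ((6 * (r / (r - 1)) + 1) ^ 2) := by
  have hc : 0 ≤ r / (r - 1) := div_nonneg (by linarith) (by linarith)
  refine lpBound_two_of_fourier fun t => ?_
  have e : ∑ j ∈ Finset.Icc (-R : ℤ) R, (diffKernel n S j : ℂ) * fourier j t =
      ∑ k ∈ S, (avgSymbol (n (k + 1)) (fourier (-1) t) - avgSymbol (n k) (fourier (-1) t)) := by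
    simp only [diffKernel, Complex.ofReal_sum, Complex.ofReal_sub, Finset.sum_mul]
    rw [Finset.sum_comm]
    refine Finset.sum_congr rfl fun k hk => ?_
    rw [← sum_avgKernel_fourier (hR k hk).1, ← sum_avgKernel_fourier (hR k hk).2,
      ← Finset.sum_sub_distrib]
    exact Finset.sum_congr rfl fun j _ => by ring
  rw [e]
  refine (norm_sum_le _ _).trans (sum_norm_avgSymbol_sub_le hr hn0 hn S ?_)
  rw [fourier_apply]
  exact Circle.norm_coe _

theorem diffKernel_eq_zero {n : ℕ → ℕ} {S : Finset ℕ} {R : ℕ}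
    (hR : ∀ k ∈ S, n k ≤ R ∧ n (k + 1) ≤ R) (j : ℤ) (hj : R < j.natAbs) :
    diffKernel n S j = 0 := by
  refine Finset.sum_eq_zero fun k hk => ?_
  obtain ⟨h1, h2⟩ := hR k hk
  have h3 : ¬ (-(n k : ℤ) ≤ j ∧ j ≤ -1) := by omega
  have h4 : ¬ (-(n (k + 1) : ℤ) ≤ j ∧ j ≤ -1) := by omega
  rw [avgKernel, avgKernel, if_neg h3, if_neg h4, sub_zero]

/-- Finite subseries of differences of lacunary averages on `ℤ` are uniformly bounded on `ℓ^q`. -/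
theorem exists_lpBound_diffKernel {n : ℕ → ℕ} (hn : IsLacunary n) {q : ℝ} (hq : 1 < q) :
    ∃ C : ℝ, 0 ≤ C ∧ ∀ (S : Finset ℕ) (R : ℕ), (∀ k ∈ S, n k ≤ R ∧ n (k + 1) ≤ R) →
      LpBound ℝ R (diffKernel n S) q C := by
  obtain ⟨hn0, r, hr, hn⟩ := hn
  have hc : 0 ≤ r / (r - 1) := div_nonneg (by linarith) (by linarith)
  obtain ⟨C, hC, h⟩ := exists_lpBound (A := (6 * (r / (r - 1)) + 1) ^ 2)
    (H := 4 * (r / (r - 1))) (by positivity) (by positivity) hq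
  exact ⟨C, hC, fun S R hR => h R _ (diffKernel_eq_zero hR)
    (lpBound_two_diffKernel hr hn0 hn S hR) (hormanderBound_diffKernel hr hn0 hn S)⟩

/-! ### Transference to measure-preserving systems -/

section Transfer

variable {𝕜 : Type*} [RCLike 𝕜]

theorem LpBound.rclike {R : ℕ} {K : ℤ → ℝ} {q C : ℝ} (hq : 1 ≤ q)
    (h : LpBound ℝ R K q C) : LpBound 𝕜 R K q (2 ^ q * C) := by
  intro f hf
  have hq0 : 0 ≤ q := by linarith
  have hre : ∀ x, RCLike.re (zconv R K f x) = zconv R K (fun y => RCLike.re (f y)) x := by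
    intro x
    simp [zconv, RCLike.smul_re]
  have him : ∀ x, RCLike.im (zconv R K f x) = zconv R K (fun y => RCLike.im (f y)) x := by
    intro x
    simp [zconv, RCLike.smul_im]
  have b1 : ∑' x, ‖RCLike.re (zconv R K f x)‖ₑ ^ q ≤ ENNReal.ofReal C * ∑' x, ‖f x‖ₑ ^ q := by
    simp only [hre]
    refine (h _ (hf.subset fun x hx h0 => hx ?_)).trans ?_
    · have : f x = 0 := h0
      simp [this]
    · gcongr with x
      exact enorm_le_iff_norm_le.2 (RCLike.norm_re_le_norm _)
  have b2 : ∑' x, ‖RCLike.im (zconv R K f x)‖ₑ ^ q ≤ ENNReal.ofReal C * ∑' x, ‖f x‖ₑ ^ q := by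
    simp only [him]
    refine (h _ (hf.subset fun x hx h0 => hx ?_)).trans ?_
    · have : f x = 0 := h0
      simp [this]
    · gcongr with x
      exact enorm_le_iff_norm_le.2 (RCLike.norm_im_le_norm _)
  have hI : ‖(RCLike.I : 𝕜)‖ ≤ 1 := by
    rcases eq_or_ne (RCLike.I : 𝕜) 0 with h0 | h0
    · simp [h0]
    · exact (RCLike.norm_I_of_ne_zero h0).le
  have hz : ∀ z : 𝕜, ‖z‖ₑ ≤ ‖RCLike.re z‖ₑ + ‖RCLike.im z‖ₑ := by
    intro z
    calc ‖z‖ₑ = ‖(RCLike.re z : 𝕜) + RCLike.im z * RCLike.I‖ₑ := by rw [RCLike.re_add_im]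
      _ ≤ ‖(RCLike.re z : 𝕜)‖ₑ + ‖(RCLike.im z : 𝕜) * RCLike.I‖ₑ := enorm_add_le _ _
      _ ≤ _ := by
        refine add_le_add (enorm_le_iff_norm_le.2 ?_) (enorm_le_iff_norm_le.2 ?_)
        · simp
        · rw [norm_mul]
          exact (mul_le_of_le_one_right (norm_nonneg _) hI).trans (by simp)
  calc ∑' x, ‖zconv R K f x‖ₑ ^ q
      ≤ ∑' x, 2 ^ (q - 1) * (‖RCLike.re (zconv R K f x)‖ₑ ^ q +
          ‖RCLike.im (zconv R K f x)‖ₑ ^ q) := by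
        refine ENNReal.tsum_le_tsum fun x => ?_
        refine le_trans ?_ (ENNReal.rpow_add_le_mul_rpow_add_rpow _ _ hq)
        gcongr
        exact hz _
    _ ≤ 2 ^ (q - 1) * (ENNReal.ofReal C * ∑' x, ‖f x‖ₑ ^ q +
          ENNReal.ofReal C * ∑' x, ‖f x‖ₑ ^ q) := by
        rw [ENNReal.tsum_mul_left, ENNReal.tsum_add]
        gcongr
    _ = _ := by
        have e : ENNReal.ofReal (2 ^ q * C) = 2 ^ (q - 1) * 2 * ENNReal.ofReal C := by
          rw [ENNReal.ofReal_mul (by positivity), ← ENNReal.ofReal_rpow_of_pos two_pos,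
            ENNReal.ofReal_ofNat]
          congr 1
          have h2 := ENNReal.rpow_add (q - 1) 1 (two_ne_zero (α := ℝ≥0∞)) ENNReal.ofNat_ne_top
          rwa [sub_add_cancel, ENNReal.rpow_one] at h2
        rw [e]
        ring

/-- The finite subseries of differences of ergodic averages, as a function. -/
noncomputable def diffAverages {X : Type*} (n : ℕ → ℕ) (S : Finset ℕ) (τ : X → X) (f : X → 𝕜)
    (x : X) : 𝕜 :=
  ∑ k ∈ S, ((n (k + 1) : 𝕜)⁻¹ * ∑ j ∈ Finset.Icc 1 (n (k + 1)), f (τ^[j] x) -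
    (n k : 𝕜)⁻¹ * ∑ j ∈ Finset.Icc 1 (n k), f (τ^[j] x))

theorem sum_avgKernel_smul {n R : ℕ} (hnR : n ≤ R) (F : ℤ → 𝕜) (i : ℤ) :
    ∑ j ∈ Finset.Icc (-R : ℤ) R, avgKernel n j • F (i - j) =
      (n : 𝕜)⁻¹ * ∑ j ∈ Finset.Icc 1 n, F (i + j) := by
  rw [Finset.mul_sum]
  symm
  refine Finset.sum_of_injOn (fun j : ℕ => -(j : ℤ)) ?_ ?_ ?_ ?_
  · intro a _ b _ h
    simp only at h
    omega
  · intro j hj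
    simp only [Finset.coe_Icc, Set.mem_Icc] at hj ⊢
    omega
  · intro j _ hj
    have : ¬ (-(n : ℤ) ≤ j ∧ j ≤ -1) := by
      rintro ⟨h1, h2⟩
      apply hj
      refine ⟨(-j).toNat, ?_, ?_⟩
      · simp only [Finset.coe_Icc, Set.mem_Icc]
        omega
      · simp only
        omega
    rw [avgKernel, if_neg this, zero_smul]
  · intro j hj
    rw [Finset.mem_Icc] at hj
    have h1 : -(n : ℤ) ≤ -(j : ℤ) ∧ -(j : ℤ) ≤ -1 := by omega
    rw [avgKernel, if_pos h1, sub_neg_eq_add, RCLike.real_smul_eq_coe_mul]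
    simp

theorem zconv_diffKernel {n : ℕ → ℕ} {S : Finset ℕ} {R : ℕ}
    (hR : ∀ k ∈ S, n k ≤ R ∧ n (k + 1) ≤ R) (F : ℤ → 𝕜) (i : ℤ) :
    zconv R (diffKernel n S) F i =
      ∑ k ∈ S, ((n (k + 1) : 𝕜)⁻¹ * ∑ j ∈ Finset.Icc 1 (n (k + 1)), F (i + j) -
        (n k : 𝕜)⁻¹ * ∑ j ∈ Finset.Icc 1 (n k), F (i + j)) := by
  simp only [zconv, diffKernel, Finset.sum_smul, sub_smul]
  rw [Finset.sum_comm]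
  refine Finset.sum_congr rfl fun k hk => ?_
  rw [Finset.sum_sub_distrib, sum_avgKernel_smul (hR k hk).1, sum_avgKernel_smul (hR k hk).2]

/-- The averages look at most `R` steps ahead, so at the first `N` points of an orbit they agree
with the convolution of the orbit segment of length `N + R`, extended by zero. Only the forward
orbit enters, so invertibility of `τ` plays no role. -/
theorem sum_diffAverages_orbit_le {n : ℕ → ℕ} {S : Finset ℕ} {R : ℕ}
    (hR : ∀ k ∈ S, n k ≤ R ∧ n (k + 1) ≤ R) {q C : ℝ} (hq : 0 < q)
    (h : LpBound 𝕜 R (diffKernel n S) q C) {X : Type*} (τ : X → X) (f : X → 𝕜) (N : ℕ) (x : X) :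
    ∑ i ∈ Finset.range N, ‖diffAverages n S τ f (τ^[i] x)‖ₑ ^ q ≤
      ENNReal.ofReal C * ∑ i ∈ Finset.range (N + R), ‖f (τ^[i] x)‖ₑ ^ q := by
  set F : ℤ → 𝕜 := fun i => if 0 ≤ i ∧ i < (N + R : ℕ) then f (τ^[i.toNat] x) else 0 with hF
  have hFz : ∀ i : ℕ, i < N + R → F i = f (τ^[i] x) := by
    intro i hi
    have : (0 : ℤ) ≤ i ∧ (i : ℤ) < (N + R : ℕ) := by omega
    simp only [hF, this, and_self, if_true, Int.toNat_natCast]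
  have hFs : F.support.Finite := by
    refine (Finset.Ico (0 : ℤ) (N + R : ℕ)).finite_toSet.subset fun i hi => ?_
    by_contra hc
    rw [Finset.mem_coe, Finset.mem_Ico] at hc
    exact hi (if_neg hc)
  have hD : ∀ i ∈ Finset.range N, diffAverages n S τ f (τ^[i] x) =
      zconv R (diffKernel n S) F i := by
    intro i hi
    rw [Finset.mem_range] at hi
    have hm : ∀ m ≤ R, ∑ j ∈ Finset.Icc 1 m, f (τ^[j] (τ^[i] x)) =
        ∑ j ∈ Finset.Icc 1 m, F (i + j) := by
      intro m hm
      refine Finset.sum_congr rfl fun j hj => ?_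
      rw [Finset.mem_Icc] at hj
      rw [← Function.iterate_add_apply, ← Nat.cast_add, hFz _ (by omega), add_comm]
    rw [zconv_diffKernel hR, diffAverages]
    refine Finset.sum_congr rfl fun k hk => ?_
    rw [hm _ (hR k hk).1, hm _ (hR k hk).2]
  have hmap : ∀ (g : ℤ → ℝ≥0∞) (M : ℕ), ∑ i ∈ Finset.range M, g i =
      ∑ i ∈ (Finset.range M).map Nat.castEmbedding, g i := fun g M => by
    rw [Finset.sum_map]
    rfl
  calc _ = ∑ i ∈ Finset.range N, ‖zconv R (diffKernel n S) F i‖ₑ ^ q :=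
        Finset.sum_congr rfl fun i hi => by rw [hD i hi]
    _ ≤ ∑' i : ℤ, ‖zconv R (diffKernel n S) F i‖ₑ ^ q := by
        rw [hmap (fun i => ‖zconv R (diffKernel n S) F i‖ₑ ^ q)]
        exact ENNReal.sum_le_tsum _
    _ ≤ ENNReal.ofReal C * ∑' i, ‖F i‖ₑ ^ q := h F hFs
    _ = _ := by
        congr 1
        rw [tsum_eq_sum (s := (Finset.range (N + R)).map Nat.castEmbedding),
          ← hmap fun i => ‖F i‖ₑ ^ q]
        · exact Finset.sum_congr rfl fun i hi => by rw [hFz i (Finset.mem_range.1 hi)]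
        · intro i hi
          have : ¬ (0 ≤ i ∧ i < (N + R : ℕ)) := by
            rintro ⟨h1, h2⟩
            apply hi
            rw [Finset.mem_map]
            refine ⟨i.toNat, Finset.mem_range.2 (by omega), ?_⟩
            simp only [Nat.castEmbedding_apply]
            omega
          rw [hF]
          dsimp only
          rw [if_neg this, enorm_zero, ENNReal.zero_rpow_of_pos hq]

variable {X : Type*} [MeasurableSpace X] {m : Measure X} {τ : X → X}

theorem stronglyMeasurable_diffAverages (hτ : Measurable τ) (n : ℕ → ℕ) (S : Finset ℕ)
    {f : X → 𝕜} (hf : StronglyMeasurable f) : StronglyMeasurable (diffAverages n S τ f) := by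
  have h : ∀ M : ℕ, StronglyMeasurable fun x =>
      (M : 𝕜)⁻¹ * ∑ j ∈ Finset.Icc 1 M, f (τ^[j] x) := fun M =>
    (Finset.stronglyMeasurable_fun_sum _ fun j _ =>
      hf.comp_measurable (hτ.iterate j)).const_mul _
  exact Finset.stronglyMeasurable_fun_sum _ fun k _ => (h _).sub (h _)

/-- Calderón's transfer of the bound on `ℤ` to measure-preserving systems. -/
theorem exists_lintegral_diffAverages_le {n : ℕ → ℕ} (hn : IsLacunary n)
    (hτ : MeasurePreserving τ m m) {q : ℝ} (hq : 1 < q) :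
    ∃ C : ℝ≥0∞, C ≠ ∞ ∧ ∀ (S : Finset ℕ) (f : X → 𝕜), StronglyMeasurable f →
      ∫⁻ x, ‖diffAverages n S τ f x‖ₑ ^ q ∂m ≤ C * ∫⁻ x, ‖f x‖ₑ ^ q ∂m := by
  obtain ⟨C, hC, h⟩ := exists_lpBound_diffKernel hn hq
  refine ⟨ENNReal.ofReal (2 ^ q * C) * 2, ENNReal.mul_ne_top ENNReal.ofReal_ne_top
    ENNReal.ofNat_ne_top, fun S f hf => ?_⟩
  obtain ⟨R, hR0, hR⟩ : ∃ R : ℕ, 0 < R ∧ ∀ k ∈ S, n k ≤ R ∧ n (k + 1) ≤ R := by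
    refine ⟨S.sup n + S.sup (fun k => n (k + 1)) + 1, by omega, fun k hk => ?_⟩
    have h1 : n k ≤ S.sup n := Finset.le_sup (f := n) hk
    have h2 : n (k + 1) ≤ S.sup (fun k => n (k + 1)) :=
      Finset.le_sup (f := fun k => n (k + 1)) hk
    omega
  have hb : LpBound 𝕜 R (diffKernel n S) q (2 ^ q * C) := (h S R hR).rclike hq.le
  have hmeas : ∀ g : X → 𝕜, StronglyMeasurable g → ∀ i : ℕ,
      Measurable fun x => ‖g (τ^[i] x)‖ₑ ^ q := fun g hg i =>
    (hg.comp_measurable (hτ.measurable.iterate i)).enorm.pow_const q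
  have hcomp : ∀ g : X → 𝕜, StronglyMeasurable g → ∀ M : ℕ,
      ∫⁻ x, ∑ i ∈ Finset.range M, ‖g (τ^[i] x)‖ₑ ^ q ∂m = M * ∫⁻ x, ‖g x‖ₑ ^ q ∂m := by
    intro g hg M
    rw [lintegral_finsetSum _ fun i _ => hmeas g hg i]
    rw [Finset.sum_congr rfl fun i _ => (hτ.iterate i).lintegral_comp (hg.enorm.pow_const q)]
    simp
  -- Taking orbit segments with `N = R` gives `R` copies of the integral on the left and `R + R` on
  -- the right, whence the factor `2`.
  have hint := lintegral_mono (μ := m)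
    fun x => sum_diffAverages_orbit_le hR (by linarith) hb τ f R x
  rw [lintegral_const_mul _ (Finset.measurable_fun_sum _ fun i _ => hmeas f hf i), hcomp f hf,
    hcomp _ (stronglyMeasurable_diffAverages hτ.measurable n S hf)] at hint
  have hR' : (R : ℝ≥0∞) ≠ 0 := by exact_mod_cast hR0.ne'
  refine (ENNReal.mul_le_mul_iff_right hR' (ENNReal.natCast_ne_top R)).1 (hint.trans (le_of_eq ?_))
  push_cast
  ring

end Transfer

/-! ### Unconditional summability in Hilbert space -/

/-- A series in a Hilbert space whose finite subset sums are bounded is summable. -/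
theorem summable_of_norm_sum_le (𝕜 : Type*) [RCLike 𝕜] {ι H : Type*} [NormedAddCommGroup H]
    [InnerProductSpace 𝕜 H] [CompleteSpace H] {u : ι → H} {B : ℝ}
    (hB : ∀ S : Finset ι, ‖∑ k ∈ S, u k‖ ≤ B) : Summable u := by
  classical
  rw [summable_iff_vanishing_norm]
  by_contra! hcon
  obtain ⟨ε, hε, hcon⟩ := hcon
  -- Failure of Cauchy's criterion supplies, outside any finite set, a block `b` of norm at least
  -- `ε`. By the parallelogram law one of `a + b`, `a - b` has squared norm at least `‖a‖ ^ 2 + ε ^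
  -- 2`, so signed sums grow without limit, while each is at most `2 * B`.
  have key : ∀ N : ℕ, ∃ P M : Finset ι, Disjoint P M ∧
      N * ε ^ 2 ≤ ‖∑ k ∈ P, u k - ∑ k ∈ M, u k‖ ^ 2 := by
    intro N
    induction N with
    | zero => exact ⟨∅, ∅, by simp, by simp⟩
    | succ N ih =>
      obtain ⟨P, M, _, hPM⟩ := ih
      obtain ⟨T, hT, hTε⟩ := hcon (P ∪ M)
      rw [Finset.disjoint_union_right] at hT
      set a := ∑ k ∈ P, u k - ∑ k ∈ M, u k
      set b := ∑ k ∈ T, u k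
      have hpar := parallelogram_law_with_norm 𝕜 a b
      have hb : ε ^ 2 ≤ ‖b‖ ^ 2 := pow_le_pow_left₀ hε.le hTε 2
      rcases le_total (‖a - b‖ ^ 2) (‖a + b‖ ^ 2) with hle | hle
      · refine ⟨P ∪ T, M, ?_, ?_⟩
        · exact Finset.disjoint_union_left.2 ⟨by assumption, hT.2⟩
        · rw [Finset.sum_union hT.1.symm, add_sub_right_comm]
          push_cast
          linarith
      · refine ⟨P, M ∪ T, ?_, ?_⟩
        · exact Finset.disjoint_union_right.2 ⟨by assumption, hT.1.symm⟩
        · rw [Finset.sum_union hT.2.symm, ← sub_sub]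
          push_cast
          linarith
  obtain ⟨N, hN⟩ := exists_nat_gt ((2 * B) ^ 2 / ε ^ 2)
  obtain ⟨P, M, _, hPM⟩ := key N
  rw [div_lt_iff₀ (by positivity)] at hN
  have h1 : ‖∑ k ∈ P, u k - ∑ k ∈ M, u k‖ ≤ 2 * B :=
    (norm_sub_le _ _).trans (by linarith [hB P, hB M])
  linarith [pow_le_pow_left₀ (norm_nonneg _) h1 2]

theorem Summable.unconditionallyConvergent {E : Type*} [AddCommMonoid E] [TopologicalSpace E]
    {u : ℕ → E} (hu : Summable u) : UnconditionallyConvergent u := fun π =>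
  ⟨∑' k, u k, ((π.hasSum_iff (f := u)).2 hu.hasSum).tendsto_sum_nat⟩

/-! ### Summability of the ergodic series in `L^p` -/

section ErgodicSeries

variable {𝕜 : Type*} [RCLike 𝕜] {X : Type*} [MeasurableSpace X] {m : Measure X} {τ : X → X}
  (hτ : MeasurePreserving τ m m) {p : ℝ≥0∞}

theorem ergodicAverage_add (N : ℕ) (f g : Lp 𝕜 p m) :
    ergodicAverage 𝕜 hτ N (f + g) = ergodicAverage 𝕜 hτ N f + ergodicAverage 𝕜 hτ N g := by
  simp only [ergodicAverage, map_add, Finset.sum_add_distrib, smul_add]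

theorem coeFn_ergodicAverage (N : ℕ) {f : Lp 𝕜 p m} {φ : X → 𝕜} (hf : f =ᵐ[m] φ) :
    ergodicAverage 𝕜 hτ N f =ᵐ[m]
      fun x => (N : 𝕜)⁻¹ * ∑ j ∈ Finset.Icc 1 N, φ (τ^[j] x) := by
  have h1 : ∀ᵐ x ∂m, ∀ j : ℕ,
      Lp.compMeasurePreserving (τ^[j]) (hτ.iterate j) f x = φ (τ^[j] x) := by
    rw [ae_all_iff]
    intro j
    filter_upwards [Lp.coeFn_compMeasurePreserving f (hτ.iterate j),
      (hτ.iterate j).quasiMeasurePreserving.ae_eq_comp hf] with x h2 h3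
    rw [h2]
    exact h3
  filter_upwards [h1, Lp.coeFn_smul (N : 𝕜)⁻¹
    (∑ k ∈ Finset.Icc 1 N, Lp.compMeasurePreserving (τ^[k]) (hτ.iterate k) f),
    Lp.coeFn_finsetSum (Finset.Icc 1 N)
      fun k => Lp.compMeasurePreserving (τ^[k]) (hτ.iterate k) f] with x h1 h2 h3
  rw [ergodicAverage, h2, Pi.smul_apply, h3, Finset.sum_apply, smul_eq_mul]
  simp only [h1]

/-- The finite subseries of differences of ergodic averages, in `L^p`. -/
theorem coeFn_sum_ergodicAverage_sub (n : ℕ → ℕ) (S : Finset ℕ) {f : Lp 𝕜 p m} {φ : X → 𝕜}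
    (hf : f =ᵐ[m] φ) :
    (∑ k ∈ S, (ergodicAverage 𝕜 hτ (n (k + 1)) f - ergodicAverage 𝕜 hτ (n k) f) : Lp 𝕜 p m)
      =ᵐ[m] diffAverages n S τ φ := by
  have h1 : ∀ᵐ x ∂m, ∀ N : ℕ, ergodicAverage 𝕜 hτ N f x =
      (N : 𝕜)⁻¹ * ∑ j ∈ Finset.Icc 1 N, φ (τ^[j] x) :=
    ae_all_iff.2 fun N => coeFn_ergodicAverage hτ N hf
  have h2 : ∀ᵐ x ∂m, ∀ k : ℕ,
      (ergodicAverage 𝕜 hτ (n (k + 1)) f - ergodicAverage 𝕜 hτ (n k) f : Lp 𝕜 p m) x =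
        ergodicAverage 𝕜 hτ (n (k + 1)) f x - ergodicAverage 𝕜 hτ (n k) f x :=
    ae_all_iff.2 fun k => Lp.coeFn_sub _ _
  filter_upwards [h1, h2, Lp.coeFn_finsetSum S
    fun k => ergodicAverage 𝕜 hτ (n (k + 1)) f - ergodicAverage 𝕜 hτ (n k) f] with x h1 h2 h3
  rw [h3, Finset.sum_apply]
  simp only [h1, h2, diffAverages]

theorem norm_sum_ergodicAverage_sub (n : ℕ → ℕ) (S : Finset ℕ) {f : Lp 𝕜 p m} {φ : X → 𝕜}
    (hf : f =ᵐ[m] φ) :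
    ‖(∑ k ∈ S, (ergodicAverage 𝕜 hτ (n (k + 1)) f - ergodicAverage 𝕜 hτ (n k) f) : Lp 𝕜 p m)‖ₑ
      = eLpNorm (diffAverages n S τ φ) p m := by
  rw [Lp.enorm_def]
  exact eLpNorm_congr_ae (coeFn_sum_ergodicAverage_sub hτ n S hf)

/-- Serves twice: at exponent `2` it feeds the Hilbert space criterion, and at exponent `p` it makes
summability a closed condition on `f`. -/
theorem exists_norm_sum_ergodicAverage_sub_le {n : ℕ → ℕ} (hn : IsLacunary n) [Fact (1 ≤ p)]
    (hp₁ : 1 < p) (hp : p < ∞) :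
    ∃ C : ℝ, 0 ≤ C ∧ ∀ (S : Finset ℕ) (f : Lp 𝕜 p m),
      ‖(∑ k ∈ S, (ergodicAverage 𝕜 hτ (n (k + 1)) f - ergodicAverage 𝕜 hτ (n k) f) : Lp 𝕜 p m)‖
        ≤ C * ‖f‖ := by
  have hq : 1 < p.toReal := by
    rw [← ENNReal.toReal_one]
    exact (ENNReal.toReal_lt_toReal ENNReal.one_ne_top hp.ne).2 hp₁
  have hq0 : 0 < p.toReal := by linarith
  have hp0 : p ≠ 0 := (zero_lt_one.trans hp₁).ne'
  obtain ⟨C, hC, h⟩ := exists_lintegral_diffAverages_le (𝕜 := 𝕜) hn hτ hq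
  have hCt : C ^ (1 / p.toReal) ≠ ∞ := ENNReal.rpow_ne_top_of_nonneg (by positivity) hC
  refine ⟨(C ^ (1 / p.toReal)).toReal, ENNReal.toReal_nonneg, fun S f => ?_⟩
  have h1 := norm_sum_ergodicAverage_sub hτ n S (EventuallyEq.refl (ae m) f)
  have h2 : eLpNorm (diffAverages n S τ f) p m ≤ C ^ (1 / p.toReal) * eLpNorm f p m := by
    rw [eLpNorm_eq_lintegral_rpow_enorm_toReal hp0 hp.ne,
      eLpNorm_eq_lintegral_rpow_enorm_toReal hp0 hp.ne,
      ← ENNReal.mul_rpow_of_nonneg _ _ (by positivity)]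
    exact ENNReal.rpow_le_rpow (h S f (Lp.stronglyMeasurable f)) (by positivity)
  rw [← h1, ← Lp.enorm_def] at h2
  have h3 := ENNReal.toReal_mono (ENNReal.mul_ne_top hCt enorm_ne_top) h2
  rwa [ENNReal.toReal_mul, toReal_enorm, toReal_enorm] at h3

/-- A log-convexity inequality between `L^2`, `L^q` and `L^{2q-2}`. -/
theorem lintegral_rpow_le_sqrt_mul_sqrt {g : X → ℝ≥0∞} (hg : AEMeasurable g m) {q : ℝ}
    (hq : 1 ≤ q) :
    ∫⁻ x, g x ^ q ∂m ≤ (∫⁻ x, g x ^ (2 : ℝ) ∂m) ^ (1 / 2 : ℝ) *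
      (∫⁻ x, g x ^ (2 * q - 2) ∂m) ^ (1 / 2 : ℝ) := by
  have h := ENNReal.lintegral_mul_le_Lp_mul_Lq m Real.HolderConjugate.two_two hg
    (hg.pow_const (q - 1))
  calc _ = ∫⁻ x, (g * fun x => g x ^ (q - 1)) x ∂m := by
        refine lintegral_congr fun x => ?_
        rw [Pi.mul_apply]
        nth_rewrite 2 [← ENNReal.rpow_one (g x)]
        rw [← ENNReal.rpow_add_of_nonneg _ _ zero_le_one (by linarith)]
        congr 1
        ring
    _ ≤ _ := by
        refine h.trans (le_of_eq ?_)
        congr 3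
        funext x
        rw [← ENNReal.rpow_mul]
        congr 1
        ring

/-- Smallness in `L^2` forces smallness in `L^q`: by inclusion of the spaces when `q ≤ 2`, otherwise
by Cauchy–Schwarz against the bounded `L^{2q-2}` integral. -/
theorem exists_forall_eLpNorm_lt [IsProbabilityMeasure m] {q : ℝ≥0∞} (hq : q ≠ ∞) (hq1 : 1 ≤ q)
    {M : ℝ≥0∞} (hM : M ≠ ∞) {ε : ℝ≥0∞} (hε : 0 < ε) (hεt : ε ≠ ∞) :
    ∃ δ : ℝ≥0∞, 0 < δ ∧ ∀ g : X → 𝕜, AEStronglyMeasurable g m →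
      (2 < q → ∫⁻ x, ‖g x‖ₑ ^ (2 * q.toReal - 2) ∂m ≤ M) → eLpNorm g 2 m < δ →
        eLpNorm g q m < ε := by
  rcases le_or_gt q 2 with h2 | h2
  · exact ⟨ε, hε, fun g hg _ hlt => (eLpNorm_le_eLpNorm_of_exponent_le h2 hg).trans_lt hlt⟩
  have hr1 : 1 ≤ q.toReal := by
    rw [← ENNReal.toReal_one]
    exact ENNReal.toReal_mono hq hq1
  have hr0 : 0 < q.toReal := by linarith
  -- The added `1` keeps the divisor nonzero when `M = 0`.
  set M' := M ^ (1 / 2 : ℝ) + 1 with hM'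
  have hM't : M' ≠ ∞ := ENNReal.add_ne_top.2
    ⟨ENNReal.rpow_ne_top_of_nonneg (by norm_num) hM, ENNReal.one_ne_top⟩
  have hM'0 : M' ≠ 0 := by simp [hM']
  have hεq : ε ^ q.toReal ≠ 0 := (ENNReal.rpow_pos hε hεt).ne'
  refine ⟨ε ^ q.toReal / M', ENNReal.div_pos hεq hM't, fun g hg hgM hlt => ?_⟩
  have e2 : eLpNorm g 2 m = (∫⁻ x, ‖g x‖ₑ ^ (2 : ℝ) ∂m) ^ (1 / 2 : ℝ) := by
    rw [eLpNorm_eq_lintegral_rpow_enorm_toReal two_ne_zero ENNReal.ofNat_ne_top,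
      ENNReal.toReal_ofNat]
  rw [eLpNorm_eq_lintegral_rpow_enorm_toReal (zero_lt_one.trans_le hq1).ne' hq, one_div,
    ENNReal.rpow_inv_lt_iff hr0]
  calc ∫⁻ x, ‖g x‖ₑ ^ q.toReal ∂m ≤ eLpNorm g 2 m * M ^ (1 / 2 : ℝ) := by
        rw [e2]
        refine (lintegral_rpow_le_sqrt_mul_sqrt hg.enorm hr1).trans ?_
        gcongr
        exact hgM h2
    _ ≤ eLpNorm g 2 m * M' := by
        gcongr
        exact le_self_add
    _ < ε ^ q.toReal := (ENNReal.lt_div_iff_mul_lt (Or.inl hM'0) (Or.inl hM't)).1 hlt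

/-- The series is summable in `L^2`, and for `p > 2` its subset sums are bounded in `L^{2p-2}`
because `2p - 2 > 1`; so the Cauchy criterion passes from `L^2` to `L^p`. -/
theorem summable_ergodicAverage_sub_indicator [IsProbabilityMeasure m] {n : ℕ → ℕ}
    (hn : IsLacunary n) [Fact (1 ≤ p)] (hp : p < ∞) {f : Lp 𝕜 p m} {φ : X → 𝕜}
    (hφ : StronglyMeasurable φ) (hφb : ∀ r, MemLp φ r m) (hf : f =ᵐ[m] φ) :
    Summable fun k : ℕ => ergodicAverage 𝕜 hτ (n (k + 1)) f - ergodicAverage 𝕜 hτ (n k) f := by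
  set f₂ : Lp 𝕜 2 m := (hφb 2).toLp φ
  have hf₂ : f₂ =ᵐ[m] φ := MemLp.coeFn_toLp _
  obtain ⟨C, _, hC⟩ := exists_norm_sum_ergodicAverage_sub_le (𝕜 := 𝕜) hτ hn (p := 2)
    ENNReal.one_lt_two ENNReal.ofNat_lt_top
  have hs2 : Summable fun k : ℕ =>
      ergodicAverage 𝕜 hτ (n (k + 1)) f₂ - ergodicAverage 𝕜 hτ (n k) f₂ :=
    summable_of_norm_sum_le 𝕜 fun S => hC S f₂
  obtain ⟨M, hM, hMb⟩ : ∃ M : ℝ≥0∞, M ≠ ∞ ∧ (2 < p → ∀ S,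
      ∫⁻ x, ‖diffAverages n S τ φ x‖ₑ ^ (2 * p.toReal - 2) ∂m ≤ M) := by
    by_cases h2 : 2 < p
    · have hr : 2 < p.toReal := by
        have := (ENNReal.toReal_lt_toReal ENNReal.ofNat_ne_top hp.ne).2 h2
        simpa using this
      have hr0 : 0 < 2 * p.toReal - 2 := by linarith
      obtain ⟨C', hC', h⟩ := exists_lintegral_diffAverages_le (𝕜 := 𝕜) hn hτ
        (q := 2 * p.toReal - 2) (by linarith)
      refine ⟨_, ENNReal.mul_ne_top hC' ?_, fun _ S => h S φ hφ⟩
      have := lintegral_rpow_enorm_lt_top_of_eLpNorm_lt_top (μ := m) (f := φ)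
        (p := ENNReal.ofReal (2 * p.toReal - 2)) (by simpa using hr0) ENNReal.ofReal_ne_top
        (hφb _).2
      rw [ENNReal.toReal_ofReal hr0.le] at this
      exact this.ne
    · exact ⟨0, ENNReal.zero_ne_top, fun h => absurd h h2⟩
  rw [summable_iff_vanishing_norm] at hs2 ⊢
  intro ε hε
  obtain ⟨δ, hδ, h⟩ := exists_forall_eLpNorm_lt (𝕜 := 𝕜) (m := m) hp.ne (Fact.out : 1 ≤ p) hM
    (ENNReal.ofReal_pos.2 hε) ENNReal.ofReal_ne_top
  obtain ⟨δ', hδ'0, hδ'⟩ : ∃ δ' : ℝ, 0 < δ' ∧ ENNReal.ofReal δ' ≤ δ := by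
    rcases eq_or_ne δ ∞ with rfl | ht
    · exact ⟨1, one_pos, le_top⟩
    · exact ⟨δ.toReal, ENNReal.toReal_pos hδ.ne' ht, (ENNReal.ofReal_toReal ht).le⟩
  obtain ⟨s, hs⟩ := hs2 δ' hδ'0
  refine ⟨s, fun t ht => ?_⟩
  have h1 := (ENNReal.ofReal_lt_ofReal_iff hδ'0).2 (hs t ht)
  rw [ofReal_norm, norm_sum_ergodicAverage_sub hτ n t hf₂] at h1
  have h3 := h _ (stronglyMeasurable_diffAverages hτ.measurable n t hφ).aestronglyMeasurable
    (fun h2 => hMb h2 t) (h1.trans_le hδ')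
  rw [← norm_sum_ergodicAverage_sub hτ n t hf, ← ofReal_norm] at h3
  exact (ENNReal.ofReal_lt_ofReal_iff hε).1 h3

theorem summable_ergodicAverage_sub [IsProbabilityMeasure m] {n : ℕ → ℕ} (hn : IsLacunary n)
    [Fact (1 ≤ p)] (hp₁ : 1 < p) (hp : p < ∞) (f : Lp 𝕜 p m) :
    Summable fun k : ℕ => ergodicAverage 𝕜 hτ (n (k + 1)) f - ergodicAverage 𝕜 hτ (n k) f := by
  have hadd : ∀ (f g : Lp 𝕜 p m) (k : ℕ),
      ergodicAverage 𝕜 hτ (n (k + 1)) (f + g) - ergodicAverage 𝕜 hτ (n k) (f + g) =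
        (ergodicAverage 𝕜 hτ (n (k + 1)) f - ergodicAverage 𝕜 hτ (n k) f) +
        (ergodicAverage 𝕜 hτ (n (k + 1)) g - ergodicAverage 𝕜 hτ (n k) g) := by
    intro f g k
    rw [ergodicAverage_add, ergodicAverage_add]
    abel
  refine Lp.induction hp.ne (motive := fun f : Lp 𝕜 p m => Summable fun k : ℕ =>
    ergodicAverage 𝕜 hτ (n (k + 1)) f - ergodicAverage 𝕜 hτ (n k) f) ?_ ?_ ?_ f
  · intro c s hs hμs
    refine summable_ergodicAverage_sub_indicator hτ hn hp
      (φ := s.indicator fun _ => c) (stronglyMeasurable_const.indicator hs)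
      (fun r => (memLp_const c).indicator hs) ?_
    rw [Lp.simpleFunc.coe_indicatorConst]
    exact indicatorConstLp_coeFn
  · intro f g hf hg _ h1 h2
    simp only [hadd]
    exact h1.add h2
  · refine isClosed_of_closure_subset fun f hf => ?_
    obtain ⟨C, hC0, hC⟩ := exists_norm_sum_ergodicAverage_sub_le (𝕜 := 𝕜) hτ hn hp₁ hp
    refine summable_iff_vanishing_norm.2 fun ε hε => ?_
    -- This radius makes `C * ‖f - g‖` less than `ε / 2`; the `+ 1` covers `C = 0`.
    obtain ⟨g, hg, hfg⟩ := Metric.mem_closure_iff.1 hf (ε / (2 * (C + 1))) (by positivity)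
    obtain ⟨s, hs⟩ := summable_iff_vanishing_norm.1 hg (ε / 2) (by positivity)
    refine ⟨s, fun t ht => ?_⟩
    have e : ∑ k ∈ t, (ergodicAverage 𝕜 hτ (n (k + 1)) f - ergodicAverage 𝕜 hτ (n k) f) =
        ∑ k ∈ t, (ergodicAverage 𝕜 hτ (n (k + 1)) (f - g) - ergodicAverage 𝕜 hτ (n k) (f - g)) +
        ∑ k ∈ t, (ergodicAverage 𝕜 hτ (n (k + 1)) g - ergodicAverage 𝕜 hτ (n k) g) := by
      rw [← Finset.sum_add_distrib]
      refine Finset.sum_congr rfl fun k _ => ?_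
      rw [← hadd, sub_add_cancel]
    rw [e]
    rw [dist_eq_norm, lt_div_iff₀ (by positivity)] at hfg
    have h1 := hC t (f - g)
    have h2 := hs t ht
    have h3 := norm_nonneg (f - g)
    refine (norm_add_le _ _).trans_lt ?_
    nlinarith

end ErgodicSeries

theorem theorem6p2 {𝕜 : Type*} [RCLike 𝕜] (n : ℕ → ℕ) (hn : IsLacunary n)
    {X : Type*} [MeasurableSpace X] (m : Measure X) [IsProbabilityMeasure m]
    (τ : X → X) (hτ : MeasurePreserving τ m m)
    (p : ℝ≥0∞) [Fact (1 ≤ p)] (hp₁ : 1 < p) (hp : p < ∞) (f : Lp 𝕜 p m) :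
    UnconditionallyConvergent
      (fun k : ℕ => ergodicAverage 𝕜 hτ (n (k + 1)) f - ergodicAverage 𝕜 hτ (n k) f) :=
  (summable_ergodicAverage_sub hτ hn hp₁ hp f).unconditionallyConvergent
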